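/- Let $r,l\ge 0$ be integers, let $\omega=(\omega_1,\dots,\omega_r)$ and $\alpha=(\alpha_1,\dots,\alpha_l)$ be vectors of complex numbers with positive real parts, let $(\omega,\alpha)=(\omega_1,\dots,\omega_r,\alpha_1,\dots,\alpha_l)$, and let $a\in\mathbb C$. For such an $\omega$ and $w\in\mathbb C$ put $f_\omega(t)=\prod_{j=1}^r(1-e^{-\omega_jt})^{-1}$, and define the multiple Bernoulli polynomials $a_{r,n}(w;\omega)$, $n\in\mathbb Z$, by the Laurent expansion at $t=0$ $$f_\omega(t)\,e^{-wt}=\sum_{n\ge -r}a_{r,n}(w;\omega)\,t^n .$$ For an integer $k\ge -r$ and $\mathrm{Re}(w)>0$, the modified BM gamma function is $$P_r(k,w;\omega)=\frac1{2\pi i}\int_{I(\lambda,\infty)}f_\omega(t)\,e^{-wt}\,t^{-k-1}\log t\,dt+(\gamma-\pi i)\,a_{r,k}(w;\omega),$$ where $\gamma$ is Euler's constant, $0<\lambda<\min_j|2\pi/\omega_j|$ (any $\lambda>0$ if $r=0$), and $I(\lambda,\infty)$ is the path that runs along the real axis from $\infty$ to $\lambda$, then once around the circle $|t|=\lambda$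 in the positive sense, then along the real axis from $\lambda$ to $\infty$, with $\log t$ continued along the path so that $\arg t$ goes from $0$ to $2\pi$. Then for every integer $k\ge -(r+l)$, and for every admissible choice of the radius $\lambda$ on the left-hand side and of the radius $\lambda$ on the right-hand side, $$P_{r+l}(k,w+a;(\omega,\alpha))=\sum_{N=-l}^{r+k}a_{l,N}(a;\alpha)\,P_r(k-N,w;\omega)+O\!\left(\frac1w\right)$$ as $|w|\to\infty$, uniformly over the $w$ with $\mathrm{Re}(w)>0$ and $\mathrm{Re}(w+a)>0$; the implied constant may depend on everything except $w$. Moreover, let $\zeta_r(s,w;\omega)$ be the analytic continuation in $s$ to $\mathbb C\setminus\{1,\dots,r\}$ of $\sum_{n\in\mathbb Z_{\ge0}^r}(n_1\omega_1+\cdots+n_r\omega_r+w)^{-s}$ (principal branch, $\mathrm{Re}(s)>r$), and let $\log\Gamma_r(w;\omega)=\frac{\partial}{\partial s}\zeta_r(s,w;\omega)\big|_{s=0}$. Then, in the same sense, $$\log\Gamma_{r+l}(w+a;(\omega,\alpha))=\sum_{N=-l}^{r}a_{l,N}(a;\alpha)\,P_r(-N,w;\omega)+O\!\left(\frac1w\right).$$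 -/

import Mathlib

open Filter Asymptotics

noncomputable section

namespace BMGamma

/-- The multiple Bernoulli polynomial `a_{r,n}(w; ω)`: the coefficient of `t ^ n` in the Laurent
expansion at `t = 0` of `e^{-wt} / ∏_j (1 - e^{-ω_j t})`. -/
def multipleBernoulli {r : ℕ} (ω : Fin r → ℂ) (n : ℤ) (w : ℂ) : ℂ :=
  HahnSeries.coeff
    (((PowerSeries.rescale (-w) (PowerSeries.exp ℂ) : PowerSeries ℂ) : LaurentSeries ℂ) /
      ∏ j, (1 - ((PowerSeries.rescale (-ω j) (PowerSeries.exp ℂ) : PowerSeries ℂ) :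
        LaurentSeries ℂ))) n

/-- The function `f_ω(t) = ∏_j (1 - e^{-ω_j t})⁻¹`. -/
def genFun {r : ℕ} (ω : Fin r → ℂ) (t : ℂ) : ℂ :=
  ∏ j, (1 - Complex.exp (-ω j * t))⁻¹

/-- The radii `0 < ρ < min_j |2π / ω_j|` (any `ρ > 0` if `r = 0`) of the circles that may be used
in the Hankel contour. -/
def IsContourRadius {r : ℕ} (ω : Fin r → ℂ) (ρ : ℝ) : Prop :=
  0 < ρ ∧ ∀ j, ρ < ‖(2 * Real.pi : ℂ) / ω j‖

/-- The integral `∫_{I(ρ, ∞)} G(t) log t dt` over the Hankel contour: in along the real half-line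
from `∞` to `ρ`, once around the circle of radius `ρ` in the positive sense, and out along the
half-line from `ρ` to `∞`. The logarithm is continued along the path, with `arg t` running
from `0` to `2π`. -/
def hankelLogIntegral (ρ : ℝ) (G : ℂ → ℂ) : ℂ :=
  -(∫ x in Set.Ioi ρ, G (x : ℂ) * (Real.log x : ℂ))
  + (∫ θ in (0 : ℝ)..(2 * Real.pi),
      G (ρ * Complex.exp (θ * Complex.I)) * ((Real.log ρ : ℂ) + θ * Complex.I)
        * (Complex.I * (ρ * Complex.exp (θ * Complex.I))))
  + (∫ x in Set.Ioi ρ, G (x : ℂ) * ((Real.log x : ℂ) + 2 * Real.pi * Complex.I))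

/-- The modified BM gamma function `P_r(k, w; ω)`, for `0 < Re w`, computed with a contour whose
circle has radius `ρ`. -/
def modifiedGamma {r : ℕ} (ρ : ℝ) (ω : Fin r → ℂ) (k : ℤ) (w : ℂ) : ℂ :=
  (1 / (2 * Real.pi * Complex.I)) *
      hankelLogIntegral ρ (fun t => genFun ω t * Complex.exp (-w * t) * t ^ (-k - 1))
    + ((Real.eulerMascheroniConstant : ℂ) - Real.pi * Complex.I) * multipleBernoulli ω k w

/-- The points `1, …, r` of the complex plane, where the multiple Hurwitz zeta function may have
poles. -/
def zetaPoles (r : ℕ) : Set ℂ := (fun m : ℕ => (m : ℂ)) '' Set.Icc 1 r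

/-- `Z` is the analytic continuation, to the complex plane without the points `1, …, r`, of the
multiple Hurwitz zeta series `∑_{n ≥ 0} (n · ω + w)^{-s}`, `Re s > r`. -/
def IsZetaContinuation {r : ℕ} (ω : Fin r → ℂ) (w : ℂ) (Z : ℂ → ℂ) : Prop :=
  DifferentiableOn ℂ Z (zetaPoles r)ᶜ ∧
    ∀ s : ℂ, (r : ℝ) < s.re →
      Z s = ∑' n : Fin r → ℕ, (∑ j, (n j : ℂ) * ω j + w) ^ (-s)

theorem zetaPoles_finite (r : ℕ) : (zetaPoles r).Finite :=
  (Set.finite_Icc 1 r).image _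

/-- The continuation is unique. -/
theorem IsZetaContinuation.unique {r : ℕ} {ω : Fin r → ℂ} {w : ℂ} {Z Z' : ℂ → ℂ}
    (h : IsZetaContinuation ω w Z) (h' : IsZetaContinuation ω w Z') :
    Set.EqOn Z Z' (zetaPoles r)ᶜ := by
  have ho : IsOpen (zetaPoles r)ᶜ := (zetaPoles_finite r).isClosed.isOpen_compl
  have hc : IsPreconnected (zetaPoles r)ᶜ :=
    ((zetaPoles_finite r).countable.isConnected_compl_of_one_lt_rank
      (by rw [Complex.rank_real_complex]; norm_num)).isPreconnected
  have hp : ((r : ℂ) + 1) ∈ (zetaPoles r)ᶜ := by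
    rintro ⟨m, hm, e⟩
    have e' : m = r + 1 := Nat.cast_injective (R := ℂ) (by simpa using e)
    have := hm.2
    omega
  refine (h.1.analyticOnNhd ho).eqOn_of_preconnected_of_eventuallyEq
    (h'.1.analyticOnNhd ho) hc hp ?_
  have hn : {s : ℂ | (r : ℝ) < s.re} ∈ nhds ((r : ℂ) + 1) :=
    (isOpen_lt continuous_const Complex.continuous_re).mem_nhds (by simp)
  filter_upwards [hn] with s hs
  rw [h.2 s hs, h'.2 s hs]

/-- The multiple Hurwitz zeta function `s ↦ ζ_r(s, w; ω)`: the analytic continuation of its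
series. -/
def multipleHurwitzZeta {r : ℕ} (ω : Fin r → ℂ) (w : ℂ) : ℂ → ℂ :=
  Classical.epsilon (IsZetaContinuation ω w)

/-- `log Γ_r(w; ω)`, that is, the derivative of `ζ_r(s, w; ω)` with respect to `s` at `s = 0`. -/
def logMultipleGamma {r : ℕ} (ω : Fin r → ℂ) (w : ℂ) : ℂ :=
  deriv (multipleHurwitzZeta ω w) 0

/-- The filter of `|w| → ∞` with both `w` and `w + a` in the right half-plane. -/
def atInfinity (a : ℂ) : Filter ℂ :=
  Bornology.cobounded ℂ ⊓ 𝓟 {w : ℂ | 0 < w.re ∧ 0 < (w + a).re}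

end BMGamma

end

/-! On the two half-lines of the Hankel contour the values of the logarithm differ by `2πi`, so the
`log` terms cancel. What remains of `P_r(k,w;ω)` is the integral of `f_ω(t) e^{-wt} t^{-k-1}` over
`(ρ,∞)`, plus `1/(2πi)` times the arc over the circle, plus the Bernoulli term (`modifiedGamma_eq`).
The value does not depend on the admissible radius, and a radius admissible for `(ω,α)` is
admissible for `ω`, so both sides can be computed on one circle.

The three parts are compared separately. The Bernoulli terms agree exactly, because the generating
series for `(ω,α)` is the product of those for `ω` and `α` (`multipleBernoulli_append`). Every tail
over `(ρ,∞)` is by itself `O(1/w)`, by integration by parts. For the arcs, truncate the Laurent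
expansion of `f_α(t) e^{-at}` after `t^{r+k}`: the remainder vanishes to an order that compensates
both `t^{-k-1}` and the pole of order `r` of `f_ω`. The combined integrand is therefore `h(t)
e^{-wt}` with `h` holomorphic on the disc and independent of `w` (`exists_holomorphic_difference`).
Its circle shrinks onto the cut, giving `2πi ∫_0^ρ h(t) e^{-wt} dt`, and one more integration by
parts makes this `O(1/w)`. All estimates use only `|e^{-wt}| ≤ 1`, hence are uniform up to the
imaginary axis.

For the second assertion it suffices that `log Γ_r(w;ω) = P_r(0,w;ω)`. The zeta function is `Γ(1-s)
e^{-πis}/(2πi)` times the Hankel integral of `f_ω(t) e^{-wt} t^{s-1}`. At `s = 0` the derivatives of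
the first two factors contribute `γ - πi` times the residue `a_{r,0}(w;ω)`, and differentiating
`t^{s-1}` produces the logarithm in the integrand. The case `k = 0` then applies. -/

noncomputable section

namespace BMGamma

open Complex Metric Set MeasureTheory
open scoped Topology

/-! ### Taylor series at the origin, as formal power series. -/

/-- The Taylor series at `0` of a function of a complex variable. -/
def taylorSeries (f : ℂ → ℂ) : PowerSeries ℂ :=
  PowerSeries.mk fun n => iteratedDeriv n f 0 / (n.factorial : ℂ)

theorem taylorSeries_congr {f g : ℂ → ℂ} (h : f =ᶠ[𝓝 0] g) :
    taylorSeries f = taylorSeries g := by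
  ext n
  simp [taylorSeries, h.iteratedDeriv_eq n]

theorem taylorSeries_mul {f g : ℂ → ℂ} (hf : AnalyticAt ℂ f 0) (hg : AnalyticAt ℂ g 0) :
    taylorSeries (f * g) = taylorSeries f * taylorSeries g := by
  ext n
  simp only [taylorSeries, PowerSeries.coeff_mk, PowerSeries.coeff_mul]
  rw [iteratedDeriv_mul hf.contDiffAt hg.contDiffAt, Finset.sum_div,
    Finset.Nat.sum_antidiagonal_eq_sum_range_succ_mk]
  refine Finset.sum_congr rfl fun i hi => ?_
  have hi' : i ≤ n := Nat.lt_succ_iff.mp (Finset.mem_range.mp hi)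
  have e : ((n.choose i : ℕ) : ℂ) * (i.factorial : ℂ) * ((n - i).factorial : ℂ)
      = (n.factorial : ℂ) := by
    exact_mod_cast congrArg (Nat.cast (R := ℂ)) (Nat.choose_mul_factorial_mul_factorial hi')
  have h1 : (i.factorial : ℂ) ≠ 0 := by exact_mod_cast i.factorial_ne_zero
  have h2 : ((n - i).factorial : ℂ) ≠ 0 := by exact_mod_cast (n - i).factorial_ne_zero
  have h4 : ((n.choose i : ℕ) : ℂ) ≠ 0 := by
    exact_mod_cast (Nat.choose_pos hi').ne'
  rw [← e]
  field_simp

theorem taylorSeries_const (c : ℂ) : taylorSeries (fun _ => c) = PowerSeries.C c := by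
  ext n
  rcases n with _ | n <;> simp [taylorSeries, iteratedDeriv_const, PowerSeries.coeff_C]

theorem taylorSeries_one : taylorSeries 1 = 1 :=
  (taylorSeries_const 1).trans (map_one _)

theorem taylorSeries_add {f g : ℂ → ℂ} (hf : AnalyticAt ℂ f 0) (hg : AnalyticAt ℂ g 0) :
    taylorSeries (f + g) = taylorSeries f + taylorSeries g := by
  ext n
  simp [taylorSeries, iteratedDeriv_add (n := n) hf.contDiffAt hg.contDiffAt, add_div]

theorem taylorSeries_exp (c : ℂ) :
    taylorSeries (fun t => exp (c * t)) = PowerSeries.rescale c (PowerSeries.exp ℂ) := by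
  ext n
  simp [taylorSeries, PowerSeries.coeff_rescale, PowerSeries.coeff_exp, div_eq_mul_inv]

theorem taylorSeries_one_sub_exp (c : ℂ) :
    taylorSeries (fun t => 1 - exp (c * t))
      = 1 - PowerSeries.rescale c (PowerSeries.exp ℂ) := by
  have h : (fun t : ℂ => 1 - exp (c * t)) + (fun t => exp (c * t)) = 1 := by
    ext t; simp
  rw [eq_sub_iff_add_eq, ← taylorSeries_exp, ← taylorSeries_add (by fun_prop) (by fun_prop), h,
    taylorSeries_one]

theorem taylorSeries_id : taylorSeries (fun t => t) = PowerSeries.X := by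
  ext n
  rcases n with _ | _ | n
  · simp [taylorSeries]
  · simp [taylorSeries]
  · simp [taylorSeries, PowerSeries.coeff_X, iteratedDeriv_succ']

theorem taylorSeries_prod {ι : Type*} (s : Finset ι) {f : ι → ℂ → ℂ}
    (hf : ∀ i ∈ s, AnalyticAt ℂ (f i) 0) :
    taylorSeries (∏ i ∈ s, f i) = ∏ i ∈ s, taylorSeries (f i) := by
  classical
  induction s using Finset.induction_on with
  | empty => simpa using taylorSeries_one
  | insert i s hi ih =>
    rw [Finset.prod_insert hi, Finset.prod_insert hi, taylorSeries_mul (hf i (by simp))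
      (Finset.analyticAt_prod s fun j hj => hf j (Finset.mem_insert_of_mem hj)),
      ih fun j hj => hf j (Finset.mem_insert_of_mem hj)]

theorem taylorSeries_pow_id (m : ℕ) :
    taylorSeries (fun t => t ^ m) = PowerSeries.X ^ m := by
  induction m with
  | zero => simpa using taylorSeries_const 1
  | succ m ih =>
    have : (fun t : ℂ => t ^ (m + 1)) = (fun t => t ^ m) * fun t => t := by
      ext t; simp [pow_succ]
    rw [this, taylorSeries_mul (by fun_prop) (by fun_prop), ih, taylorSeries_id, pow_succ]

theorem differentiableOn_dslope_ball {f : ℂ → ℂ} {R : ℝ} (hR : 0 < R)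
    (hf : DifferentiableOn ℂ f (ball 0 R)) : DifferentiableOn ℂ (dslope f 0) (ball 0 R) :=
  (Complex.differentiableOn_dslope (ball_mem_nhds 0 hR)).2 hf

theorem analyticAt_zero_of_ball {f : ℂ → ℂ} {R : ℝ} (hR : 0 < R)
    (hf : DifferentiableOn ℂ f (ball 0 R)) : AnalyticAt ℂ f 0 :=
  hf.analyticAt (ball_mem_nhds 0 hR)

/-- Since `f(t) = f(0) + t · dslope f 0 t`, passing to the slope shifts the coefficients by one and
keeps the disc of holomorphy; this is the inductive step of Taylor's formula. -/
theorem taylorSeries_eq_add_X_mul {f : ℂ → ℂ} {R : ℝ} (hR : 0 < R)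
    (hf : DifferentiableOn ℂ f (ball 0 R)) :
    taylorSeries f = PowerSeries.C (f 0) + PowerSeries.X * taylorSeries (dslope f 0) := by
  have e : f = (fun _ => f 0) + (fun t => t) * dslope f 0 := by
    ext t
    have := sub_smul_dslope f 0 t
    simp only [sub_zero, smul_eq_mul] at this
    simp [this]
  have ha := analyticAt_zero_of_ball hR (differentiableOn_dslope_ball hR hf)
  conv_lhs => rw [e]
  rw [taylorSeries_add (by fun_prop) ((by fun_prop : AnalyticAt ℂ (fun t : ℂ => t) 0).mul ha),
    taylorSeries_mul (by fun_prop) ha, taylorSeries_const, taylorSeries_id]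

/-- Taylor's formula with a remainder that is holomorphic on the whole disc. -/
theorem exists_taylor_remainder {R : ℝ} (hR : 0 < R) (K : ℕ) :
    ∀ f : ℂ → ℂ, DifferentiableOn ℂ f (ball 0 R) →
      ∃ h : ℂ → ℂ, DifferentiableOn ℂ h (ball 0 R) ∧
        ∀ t, f t = ∑ n ∈ Finset.range K, (taylorSeries f).coeff n * t ^ n + t ^ K * h t := by
  induction K with
  | zero => exact fun f hf => ⟨f, hf, by simp⟩
  | succ K ih =>
    intro f hf
    obtain ⟨h, hh, e⟩ := ih _ (differentiableOn_dslope_ball hR hf)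
    refine ⟨h, hh, fun t => ?_⟩
    have h1 := sub_smul_dslope f 0 t
    simp only [sub_zero, smul_eq_mul] at h1
    rw [e t] at h1
    rw [Finset.sum_range_succ', taylorSeries_eq_add_X_mul hR hf]
    simp only [map_add, PowerSeries.coeff_succ_X_mul, PowerSeries.coeff_succ_C, zero_add,
      PowerSeries.coeff_zero_eq_constantCoeff, PowerSeries.constantCoeff_C, map_mul,
      PowerSeries.constantCoeff_X, zero_mul, add_zero, pow_zero, mul_one]
    rw [mul_add, Finset.mul_sum] at h1
    have : ∑ n ∈ Finset.range K, (taylorSeries (dslope f 0)).coeff n * t ^ (n + 1)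
        = ∑ n ∈ Finset.range K, t * ((taylorSeries (dslope f 0)).coeff n * t ^ n) :=
      Finset.sum_congr rfl fun n _ => by ring
    rw [this]
    linear_combination -h1

/-! ### The formal Bernoulli series and the analytic generating function. -/

/-- The Laurent series of `e^{-wt} / ∏_j (1 - e^{-ω_j t})`. -/
def bernoulliSeries {r : ℕ} (ω : Fin r → ℂ) (w : ℂ) : LaurentSeries ℂ :=
  ((PowerSeries.rescale (-w) (PowerSeries.exp ℂ) : PowerSeries ℂ) : LaurentSeries ℂ) /
    ∏ j, (1 - ((PowerSeries.rescale (-ω j) (PowerSeries.exp ℂ) : PowerSeries ℂ) :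
      LaurentSeries ℂ))

/-- The zeros are the multiples `2πin/c`, and those with `n ≠ 0` have modulus at least `|2π/c|`. -/
theorem one_sub_exp_ne_zero {c t : ℂ} {R : ℝ} (hR : R ≤ ‖(2 * Real.pi : ℂ) / c‖) (hc : c ≠ 0)
    (ht : t ≠ 0) (htR : ‖t‖ < R) : 1 - exp (-c * t) ≠ 0 := by
  intro h
  obtain ⟨n, hn⟩ := Complex.exp_eq_one_iff.1 (sub_eq_zero.1 h).symm
  have hn0 : n ≠ 0 := by
    rintro rfl
    simp [hc, ht] at hn
  have h1 : (1 : ℝ) ≤ ‖(n : ℂ)‖ := by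
    rw [Complex.norm_intCast]
    exact_mod_cast Int.one_le_abs hn0
  have h2 := congrArg norm hn
  rw [norm_mul, norm_mul, norm_neg, norm_mul, norm_I, mul_one] at h2
  rw [norm_div] at hR
  have hcp : 0 < ‖c‖ := norm_pos_iff.2 hc
  have h3 := htR.trans_le hR
  rw [lt_div_iff₀ hcp] at h3
  nlinarith [norm_nonneg (2 * (Real.pi : ℂ))]

/-- The entire function `(1 - e^{-ct}) / t`. -/
def expSlope (c : ℂ) : ℂ → ℂ := dslope (fun t => 1 - exp (-c * t)) 0

theorem mul_expSlope (c t : ℂ) : t * expSlope c t = 1 - exp (-c * t) := by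
  simpa [expSlope] using sub_smul_dslope (fun t => 1 - exp (-c * t)) 0 t

theorem differentiable_expSlope (c : ℂ) : Differentiable ℂ (expSlope c) := by
  rw [← differentiableOn_univ]
  exact (Complex.differentiableOn_dslope univ_mem).2 (by fun_prop)

theorem expSlope_ne_zero {c t : ℂ} {R : ℝ} (hR : R ≤ ‖(2 * Real.pi : ℂ) / c‖) (hc : c ≠ 0)
    (htR : ‖t‖ < R) : expSlope c t ≠ 0 := by
  rcases eq_or_ne t 0 with rfl | ht
  · have : HasDerivAt (fun t : ℂ => 1 - exp (-c * t)) (-(exp (-c * 0) * (-c * 1))) 0 :=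
      (((hasDerivAt_id (0 : ℂ)).const_mul (-c)).cexp).const_sub 1
    rw [expSlope, dslope_same, this.deriv]
    simpa using hc
  · intro h
    apply one_sub_exp_ne_zero hR hc ht htR
    rw [← mul_expSlope, h, mul_zero]

/-- The regular part `t ^ r f_ω(t) e^{-wt}` of the generating function. -/
def regGenFun {r : ℕ} (ω : Fin r → ℂ) (w : ℂ) (t : ℂ) : ℂ :=
  exp (-w * t) * ∏ j, (expSlope (ω j) t)⁻¹

section
variable {r : ℕ} {ω : Fin r → ℂ} {R : ℝ}

theorem differentiableOn_regGenFun (hω : ∀ j, ω j ≠ 0)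
    (hR : ∀ j, R ≤ ‖(2 * Real.pi : ℂ) / ω j‖) (w : ℂ) :
    DifferentiableOn ℂ (regGenFun ω w) (ball 0 R) := by
  refine DifferentiableOn.mul (by fun_prop) ?_
  refine DifferentiableOn.fun_finsetProd fun j _ => ?_
  exact (differentiable_expSlope _).differentiableOn.inv fun t ht =>
    expSlope_ne_zero (hR j) (hω j) (by simpa using ht)

theorem pow_mul_genFun_mul_exp (w : ℂ) {t : ℂ} (ht : t ≠ 0) :
    t ^ r * (genFun ω t * exp (-w * t)) = regGenFun ω w t := by
  have : ∀ j, (expSlope (ω j) t)⁻¹ = t * (1 - exp (-ω j * t))⁻¹ := fun j => by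
    rw [← mul_expSlope]
    field_simp
  simp only [regGenFun, this, Finset.prod_mul_distrib, Finset.prod_const, Finset.card_univ,
    Fintype.card_fin, genFun]
  ring

/-- With denominators cleared, both sides are Taylor series of analytic functions that agree near
`0`. This links the formal quotient defining the Bernoulli polynomials to the actual function. -/
theorem taylorSeries_regGenFun (hω : ∀ j, ω j ≠ 0) (hR0 : 0 < R)
    (hR : ∀ j, R ≤ ‖(2 * Real.pi : ℂ) / ω j‖) (w : ℂ) :
    taylorSeries (regGenFun ω w) * ∏ j, (1 - PowerSeries.rescale (-ω j) (PowerSeries.exp ℂ))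
      = PowerSeries.X ^ r * PowerSeries.rescale (-w) (PowerSeries.exp ℂ) := by
  have hQ := analyticAt_zero_of_ball hR0 (differentiableOn_regGenFun hω hR w)
  have hp : ∀ j ∈ Finset.univ, AnalyticAt ℂ (fun t : ℂ => 1 - exp (-ω j * t)) 0 :=
    fun j _ => by fun_prop
  rw [Finset.prod_congr rfl fun j _ => (taylorSeries_one_sub_exp (-ω j)).symm,
    ← taylorSeries_prod _ hp, ← taylorSeries_mul hQ (Finset.analyticAt_prod _ hp),
    ← taylorSeries_exp, ← taylorSeries_pow_id, ← taylorSeries_mul (by fun_prop) (by fun_prop)]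
  apply taylorSeries_congr
  filter_upwards [ball_mem_nhds 0 hR0] with t ht
  have h : ∀ j, expSlope (ω j) t ≠ 0 := fun j =>
    expSlope_ne_zero (hR j) (hω j) (by simpa using ht)
  simp only [Pi.mul_apply, Finset.prod_apply, regGenFun, ← mul_expSlope,
    Finset.prod_mul_distrib, Finset.prod_const, Finset.card_univ, Fintype.card_fin,
    Finset.prod_inv_distrib]
  have h' : ∏ j, expSlope (ω j) t ≠ 0 := Finset.prod_ne_zero_iff.2 fun j _ => h j
  field_simp

theorem exists_pos_radius (hω : ∀ j, ω j ≠ 0) :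
    ∃ R : ℝ, 0 < R ∧ ∀ j, R ≤ ‖(2 * Real.pi : ℂ) / ω j‖ := by
  have hp : ∀ j, 0 < ‖(2 * Real.pi : ℂ) / ω j‖ := fun j =>
    norm_pos_iff.2 (div_ne_zero (by simp [Real.pi_ne_zero]) (hω j))
  rcases isEmpty_or_nonempty (Fin r) with h | h
  · exact ⟨1, one_pos, fun j => h.elim j⟩
  · refine ⟨Finset.univ.inf' Finset.univ_nonempty fun j => ‖(2 * Real.pi : ℂ) / ω j‖, ?_,
      fun j => Finset.inf'_le _ (Finset.mem_univ j)⟩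
    exact (Finset.lt_inf'_iff _).2 fun j _ => hp j

theorem one_sub_rescale_exp_ne_zero {c : ℂ} (hc : c ≠ 0) :
    (1 - ((PowerSeries.rescale (-c) (PowerSeries.exp ℂ) : PowerSeries ℂ) :
      LaurentSeries ℂ)) ≠ 0 := by
  rw [← PowerSeries.coe_one, ← PowerSeries.coe_sub]
  intro h
  have h1 : ((1 - PowerSeries.rescale (-c) (PowerSeries.exp ℂ) : PowerSeries ℂ)) = 0 := by
    apply HahnSeries.ofPowerSeries_injective (Γ := ℤ) (R := ℂ)
    rw [h, map_zero]
  have h2 := congrArg (PowerSeries.coeff 1) h1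
  simp [PowerSeries.coeff_rescale, PowerSeries.coeff_exp, PowerSeries.coeff_one, hc] at h2

theorem bernoulliSeries_eq (hω : ∀ j, ω j ≠ 0) (w : ℂ) :
    bernoulliSeries ω w = HahnSeries.single (-(r : ℤ)) 1 *
      ((taylorSeries (regGenFun ω w) : PowerSeries ℂ) : LaurentSeries ℂ) := by
  obtain ⟨R, hR0, hR⟩ := exists_pos_radius hω
  have h := congrArg (HahnSeries.ofPowerSeries ℤ ℂ) (taylorSeries_regGenFun hω hR0 hR w)
  rw [map_mul, map_mul, map_prod, HahnSeries.ofPowerSeries_X_pow] at h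
  simp only [map_sub, map_one] at h
  have hne : ∏ j, (1 - ((PowerSeries.rescale (-ω j) (PowerSeries.exp ℂ) : PowerSeries ℂ) :
      LaurentSeries ℂ)) ≠ 0 :=
    Finset.prod_ne_zero_iff.2 fun j _ => one_sub_rescale_exp_ne_zero (hω j)
  rw [bernoulliSeries, div_eq_iff hne, mul_assoc, h, ← mul_assoc, HahnSeries.single_mul_single]
  simp

theorem multipleBernoulli_eq_coeff (hω : ∀ j, ω j ≠ 0) (w : ℂ) (m : ℕ) :
    multipleBernoulli ω (m - r) w = (taylorSeries (regGenFun ω w)).coeff m := by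
  change (bernoulliSeries ω w).coeff _ = _
  rw [bernoulliSeries_eq hω, HahnSeries.coeff_single_mul, one_mul,
    show (m : ℤ) - r - -(r : ℤ) = (m : ℤ) by ring, LaurentSeries.coeff_coe_powerSeries]

/-- The Laurent expansion of `f_ω(t) e^{-wt}` with a holomorphic remainder. -/
theorem exists_laurent_remainder (hω : ∀ j, ω j ≠ 0) (hR0 : 0 < R)
    (hR : ∀ j, R ≤ ‖(2 * Real.pi : ℂ) / ω j‖) (w : ℂ) (M : ℤ) (hM : -(r : ℤ) ≤ M + 1) :
    ∃ h : ℂ → ℂ, DifferentiableOn ℂ h (ball 0 R) ∧ ∀ t, t ≠ 0 →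
      genFun ω t * exp (-w * t) =
        ∑ N ∈ Finset.Icc (-(r : ℤ)) M, multipleBernoulli ω N w * t ^ N + t ^ (M + 1) * h t := by
  -- The exponents `-r, …, M` correspond to the first `K = M + 1 + r` Taylor coefficients of the
  -- regular part; `K = 0` is allowed and means an empty sum.
  obtain ⟨K, hK⟩ := Int.eq_ofNat_of_zero_le (show 0 ≤ M + 1 + r by linarith)
  obtain ⟨h, hh, e⟩ := exists_taylor_remainder hR0 K _ (differentiableOn_regGenFun hω hR w)
  refine ⟨h, hh, fun t ht => ?_⟩
  have htr : t ^ (r : ℤ) ≠ 0 := zpow_ne_zero _ ht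
  have hsum : ∑ N ∈ Finset.Icc (-(r : ℤ)) M, multipleBernoulli ω N w * t ^ N
      = ∑ n ∈ Finset.range K,
        multipleBernoulli ω ((n : ℤ) - r) w * t ^ ((n : ℤ) - r) := by
    symm
    refine Finset.sum_bij (fun n _ => (n : ℤ) - r) ?_ ?_ ?_ ?_
    · intro n hn
      rw [Finset.mem_range] at hn
      rw [Finset.mem_Icc]
      omega
    · intro n _ n' _ hnn
      omega
    · intro N hN
      rw [Finset.mem_Icc] at hN
      exact ⟨(N + r).toNat, by rw [Finset.mem_range]; omega, by omega⟩
    · intro n _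
      rfl
  have e1 := e t
  rw [← pow_mul_genFun_mul_exp w ht] at e1
  apply mul_left_cancel₀ htr
  rw [hsum, mul_add, Finset.mul_sum, zpow_natCast, e1]
  congr 1
  · refine Finset.sum_congr rfl fun n _ => ?_
    rw [multipleBernoulli_eq_coeff hω, zpow_sub₀ ht, zpow_natCast, zpow_natCast]
    field_simp
  · rw [← mul_assoc, ← zpow_natCast t r, ← zpow_add₀ ht, ← zpow_natCast t K]
    congr 2
    omega

end

theorem bernoulliSeries_append {r l : ℕ} (ω : Fin r → ℂ) (α : Fin l → ℂ) (w a : ℂ) :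
    bernoulliSeries (Fin.append ω α) (w + a) = bernoulliSeries α a * bernoulliSeries ω w := by
  have h : PowerSeries.rescale (-(w + a)) (PowerSeries.exp ℂ)
      = PowerSeries.rescale (-w) (PowerSeries.exp ℂ)
        * PowerSeries.rescale (-a) (PowerSeries.exp ℂ) := by
    rw [PowerSeries.exp_mul_exp_eq_exp_add, neg_add]
  simp only [bernoulliSeries, h, Fin.prod_univ_add, Fin.append_left, Fin.append_right,
    PowerSeries.coe_mul]
  rw [div_mul_div_comm, mul_comm (∏ i, _), mul_comm (HahnSeries.ofPowerSeries _ _ _)]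

/-- This is the Cauchy product of two Laurent series. They start at the exponents `-l` and `-r`, so
only `-l ≤ N ≤ r + k` contribute. -/
theorem multipleBernoulli_append {r l : ℕ} {ω : Fin r → ℂ} {α : Fin l → ℂ}
    (hω : ∀ j, ω j ≠ 0) (hα : ∀ j, α j ≠ 0) (w a : ℂ) (k : ℤ) (hk : -((r : ℤ) + l) ≤ k) :
    multipleBernoulli (Fin.append ω α) k (w + a) =
      ∑ N ∈ Finset.Icc (-(l : ℤ)) ((r : ℤ) + k),
        multipleBernoulli α N a * multipleBernoulli ω (k - N) w := by
  obtain ⟨K, hK⟩ := Int.eq_ofNat_of_zero_le (show 0 ≤ k + r + l by linarith)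
  change (bernoulliSeries (Fin.append ω α) (w + a)).coeff k = _
  rw [bernoulliSeries_append, bernoulliSeries_eq hα, bernoulliSeries_eq hω, mul_mul_mul_comm,
    HahnSeries.single_mul_single, ← PowerSeries.coe_mul, HahnSeries.coeff_single_mul,
    show k - (-(l : ℤ) + -(r : ℤ)) = (K : ℤ) by omega, LaurentSeries.coeff_coe_powerSeries,
    PowerSeries.coeff_mul, mul_one, one_mul]
  refine Finset.sum_bij (fun p _ => (p.1 : ℤ) - l) ?_ ?_ ?_ ?_
  · intro p hp
    rw [Finset.HasAntidiagonal.mem_antidiagonal] at hp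
    rw [Finset.mem_Icc]
    omega
  · intro p hp q hq hpq
    rw [Finset.HasAntidiagonal.mem_antidiagonal] at hp hq
    ext <;> omega
  · intro N hN
    rw [Finset.mem_Icc] at hN
    exact ⟨((N + l).toNat, K - (N + l).toNat), by rw [Finset.HasAntidiagonal.mem_antidiagonal]; omega,
      by simp only; omega⟩
  · intro p hp
    rw [Finset.HasAntidiagonal.mem_antidiagonal] at hp
    rw [multipleBernoulli_eq_coeff hα, show k - ((p.1 : ℤ) - l) = (p.2 : ℤ) - r by omega,
      multipleBernoulli_eq_coeff hω]

/-! ### Arcs of the Hankel contour and Cauchy's theorem in the variable `log t`. -/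

/-- The part over the circle of radius `ρ` of the integral of `F(t) κ(log t)` over the Hankel
contour, where `arg t` runs from `0` to `2π`. -/
def arcIntegral (F κ : ℂ → ℂ) (ρ : ℝ) : ℂ :=
  ∫ θ in (0 : ℝ)..(2 * Real.pi),
    F (ρ * exp (θ * I)) * κ ((Real.log ρ : ℂ) + θ * I) * (I * (ρ * exp (θ * I)))

/-- The difference of the values of `F(t) κ(log t)` on the two sides of the cut. -/
def cutJump (F κ : ℂ → ℂ) (t : ℝ) : ℂ :=
  F t * (κ (Real.log t + 2 * Real.pi * I) - κ (Real.log t))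

theorem continuousOn_cutJump {F κ : ℂ → ℂ} (hκ : Continuous κ) {s : Set ℝ}
    (hs : ∀ t ∈ s, 0 < t) (hF : ContinuousOn (fun t : ℝ => F t) s) :
    ContinuousOn (cutJump F κ) s := by
  have hl : ContinuousOn (fun t : ℝ => (Real.log t : ℂ)) s :=
    continuous_ofReal.comp_continuousOn
      (Real.continuousOn_log.mono fun t ht => (hs t ht).ne')
  exact hF.mul ((hκ.comp_continuousOn (hl.add continuousOn_const)).sub (hκ.comp_continuousOn hl))

/-- In the variable `z = log t` the annulus cut along the positive axis becomes a rectangle of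
height `2π`. Cauchy's theorem applies there: the vertical sides are the two arcs, and the horizontal
sides are the two edges of the cut. -/
theorem arcIntegral_sub {F κ : ℂ → ℂ} {R ρ₁ ρ₂ : ℝ}
    (hF : DifferentiableOn ℂ F (ball 0 R \ {0})) (hκ : Differentiable ℂ κ)
    (h₁ : 0 < ρ₁) (h₁₂ : ρ₁ ≤ ρ₂) (h₂ : ρ₂ < R) :
    arcIntegral F κ ρ₂ - arcIntegral F κ ρ₁ = ∫ t in ρ₁..ρ₂, cutJump F κ t := by
  have h₂' : 0 < ρ₂ := h₁.trans_le h₁₂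
  have hle : Real.log ρ₁ ≤ Real.log ρ₂ := Real.log_le_log h₁ h₁₂
  -- The extra factor `I` makes the restriction of `Φ` to a vertical side equal to the integrand of
  -- `arcIntegral`; it is cancelled at the end.
  set Φ : ℂ → ℂ := fun z => F (exp z) * κ z * (I * exp z) with hΦ
  have hmem : ∀ z : ℂ, z.re ≤ Real.log ρ₂ → exp z ∈ ball (0 : ℂ) R \ {0} := fun z hz => by
    refine ⟨?_, exp_ne_zero z⟩
    rw [mem_ball_zero_iff, norm_exp]
    calc Real.exp z.re ≤ Real.exp (Real.log ρ₂) := Real.exp_le_exp.2 hz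
      _ = ρ₂ := Real.exp_log h₂'
      _ < R := h₂
  have hd : DifferentiableOn ℂ Φ {z | z.re ≤ Real.log ρ₂} := by
    refine ((hF.comp differentiable_exp.differentiableOn fun z hz => hmem z hz).mul
      hκ.differentiableOn).mul ?_
    exact (differentiable_exp.const_mul I).differentiableOn
  have hrect := integral_boundary_rect_eq_zero_of_differentiableOn Φ
    (⟨Real.log ρ₁, 0⟩ : ℂ) (⟨Real.log ρ₂, 2 * Real.pi⟩ : ℂ) (hd.mono fun z hz => by
      have := hz.1
      rw [mem_preimage, uIcc_of_le hle] at this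
      exact this.2)
  simp only [ofReal_zero, zero_mul, add_zero, smul_eq_mul] at hrect
  have hright : ∀ ρ : ℝ, 0 < ρ →
      ∫ y in (0 : ℝ)..(2 * Real.pi), Φ (Real.log ρ + y * I) = arcIntegral F κ ρ := fun ρ hρ => by
    refine intervalIntegral.integral_congr fun θ _ => ?_
    have : exp ((Real.log ρ : ℂ) + θ * I) = ρ * exp (θ * I) := by
      rw [exp_add, ← ofReal_exp, Real.exp_log hρ]
    simp only [hΦ, this]
  rw [hright ρ₁ h₁, hright ρ₂ h₂'] at hrect
  have hcont : ContinuousOn (cutJump F κ) (Icc ρ₁ ρ₂) := by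
    refine continuousOn_cutJump hκ.continuous (fun t ht => h₁.trans_le ht.1) ?_
    refine hF.continuousOn.comp continuous_ofReal.continuousOn fun t ht => ⟨?_, ?_⟩
    · rw [mem_ball_zero_iff, norm_real, Real.norm_of_nonneg (h₁.le.trans ht.1)]
      exact ht.2.trans_lt h₂
    · exact ofReal_ne_zero.2 (h₁.trans_le ht.1).ne'
  have himg : Real.exp '' uIcc (Real.log ρ₁) (Real.log ρ₂) ⊆ Icc ρ₁ ρ₂ := by
    rintro _ ⟨x, hx, rfl⟩
    rw [uIcc_of_le hle] at hx
    exact ⟨(Real.log_le_iff_le_exp h₁).1 hx.1, (Real.le_log_iff_exp_le h₂').1 hx.2⟩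
  have hsubst := intervalIntegral.integral_deriv_smul_comp' (a := Real.log ρ₁)
    (b := Real.log ρ₂) (f := Real.exp) (f' := Real.exp) (g := cutJump F κ)
    (fun x _ => Real.hasDerivAt_exp x) Real.continuous_exp.continuousOn (hcont.mono himg)
  rw [Real.exp_log h₁, Real.exp_log h₂'] at hsubst
  have hline : ∀ y : ℝ, IntervalIntegrable (fun x : ℝ => Φ (x + y * I)) volume
      (Real.log ρ₁) (Real.log ρ₂) := fun y => by
    refine ContinuousOn.intervalIntegrable ?_
    refine hd.continuousOn.comp (by fun_prop) fun x hx => ?_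
    rw [uIcc_of_le hle] at hx
    simpa using hx.2
  have h0 := hline 0
  simp only [ofReal_zero, zero_mul, add_zero] at h0
  have htwo : (∫ x in Real.log ρ₁..Real.log ρ₂, Φ (x + (2 * Real.pi : ℝ) * I))
      - ∫ x in Real.log ρ₁..Real.log ρ₂, Φ x = I * ∫ t in ρ₁..ρ₂, cutJump F κ t := by
    rw [← hsubst, ← intervalIntegral.integral_sub (hline _) h0,
      ← intervalIntegral.integral_const_mul]
    refine intervalIntegral.integral_congr fun x _ => ?_
    have he : exp ((x : ℂ) + (2 * Real.pi : ℝ) * I) = exp x := by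
      rw [show ((2 * Real.pi : ℝ) : ℂ) * I = 2 * Real.pi * I by push_cast; ring]
      exact exp_periodic x
    simp only [hΦ, he, cutJump, Function.comp, Real.log_exp, real_smul, ofReal_exp]
    push_cast
    ring
  have : I * (arcIntegral F κ ρ₂ - arcIntegral F κ ρ₁) = I * ∫ t in ρ₁..ρ₂, cutJump F κ t := by
    rw [← htwo]
    linear_combination hrect
  exact mul_left_cancel₀ I_ne_zero this

/-- Let the inner radius in `arcIntegral_sub` tend to `0`: the inner arc disappears and only the cut
remains. -/
theorem arcIntegral_eq_integral {F κ : ℂ → ℂ} {R ρ : ℝ}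
    (hF : DifferentiableOn ℂ F (ball 0 R \ {0})) (hκ : Differentiable ℂ κ)
    (hρ : 0 < ρ) (hρR : ρ < R) (hint : IntervalIntegrable (cutJump F κ) volume 0 ρ)
    (hlim : Tendsto (arcIntegral F κ) (𝓝[>] 0) (𝓝 0)) :
    arcIntegral F κ ρ = ∫ t in (0 : ℝ)..ρ, cutJump F κ t := by
  have h1 : Tendsto (fun x => ∫ t in x..ρ, cutJump F κ t) (𝓝[>] 0)
      (𝓝 (∫ t in (0 : ℝ)..ρ, cutJump F κ t)) := by
    have hc := intervalIntegral.continuousOn_primitive_interval_left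
      ((intervalIntegrable_iff' (by simp)).1 hint)
    have := hc 0 left_mem_uIcc
    rw [uIcc_of_le hρ.le] at this
    refine this.mono_left ?_
    rw [← nhdsWithin_Ioc_eq_nhdsGT hρ]
    exact nhdsWithin_mono _ Ioc_subset_Icc_self
  have h2 : Tendsto (fun x => arcIntegral F κ ρ - arcIntegral F κ x) (𝓝[>] 0)
      (𝓝 (arcIntegral F κ ρ - 0)) := tendsto_const_nhds.sub hlim
  rw [sub_zero] at h2
  refine tendsto_nhds_unique (h2.congr' ?_) h1
  filter_upwards [Ioc_mem_nhdsGT hρ] with x hx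
  exact arcIntegral_sub hF hκ hx.1 hx.2 hρR

theorem norm_arcIntegral_le {F κ : ℂ → ℂ} {ρ A B : ℝ} (hρ : 0 < ρ)
    (hF : ∀ t : ℂ, ‖t‖ = ρ → ‖F t‖ ≤ A)
    (hκ : ∀ θ ∈ Icc (0 : ℝ) (2 * Real.pi), ‖κ (Real.log ρ + θ * I)‖ ≤ B) :
    ‖arcIntegral F κ ρ‖ ≤ A * B * ρ * (2 * Real.pi) := by
  have hB : 0 ≤ B := (norm_nonneg _).trans (hκ 0 ⟨le_rfl, by positivity⟩)
  have h := intervalIntegral.norm_integral_le_of_norm_le_const (a := 0) (b := 2 * Real.pi)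
    (f := fun θ : ℝ => F (ρ * exp (θ * I)) * κ ((Real.log ρ : ℂ) + θ * I)
      * (I * (ρ * exp (θ * I)))) (C := A * B * ρ) fun θ hθ => by
    have hn : ‖(ρ : ℂ) * exp (θ * I)‖ = ρ := by
      rw [norm_mul, norm_exp_ofReal_mul_I, norm_real, Real.norm_of_nonneg hρ.le, mul_one]
    have hA := hF _ hn
    rw [uIoc_of_le (by positivity)] at hθ
    rw [norm_mul, norm_mul, norm_mul I, norm_I, one_mul, hn]
    have := hκ θ ⟨hθ.1.le, hθ.2⟩
    gcongr
    exact (norm_nonneg _).trans hA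
  rwa [sub_zero, abs_of_pos (by positivity)] at h

/-! ### Subexponential growth and integrability on half-lines. -/

/-- Functions that grow slower than every exponential. -/
def SubExp (ψ : ℝ → ℂ) : Prop :=
  ∀ ε : ℝ, 0 < ε → ψ =O[atTop] fun t => Real.exp (ε * t)

theorem SubExp.mul {φ ψ : ℝ → ℂ} (hφ : SubExp φ) (hψ : SubExp ψ) :
    SubExp fun t => φ t * ψ t := fun ε hε => by
  refine ((hφ (ε / 2) (by positivity)).mul (hψ (ε / 2) (by positivity))).congr_right fun t => ?_
  rw [← Real.exp_add]
  ring_nf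

theorem SubExp.of_isBigO_one {φ : ℝ → ℂ} (h : φ =O[atTop] fun _ => (1 : ℝ)) : SubExp φ :=
  fun ε hε => h.trans <| (Real.isBigO_one_exp_comp (f := fun t => ε * t)).2 <| by
    refine ⟨0, ?_⟩
    rw [eventually_map]
    filter_upwards [eventually_ge_atTop 0] with t ht
    positivity

theorem SubExp.const (c : ℂ) : SubExp fun _ => c :=
  .of_isBigO_one (isBigO_const_const c one_ne_zero _)

theorem SubExp.zpow (m : ℤ) : SubExp fun t : ℝ => (t : ℂ) ^ m := fun ε hε => by
  refine (IsBigO.of_norm_left ?_)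
  refine ((isLittleO_zpow_exp_pos_mul_atTop m hε).isBigO.norm_left).congr_left fun t => ?_
  rw [norm_zpow, norm_zpow, norm_real]

theorem SubExp.log : SubExp fun t : ℝ => (Real.log t : ℂ) := fun ε hε => by
  refine IsBigO.of_norm_left ?_
  have h := (Real.isLittleO_log_id_atTop.isBigO.trans
    ((isLittleO_zpow_exp_pos_mul_atTop 1 hε).isBigO.congr_left fun t => zpow_one t)).norm_left
  exact h.congr_left fun t => by rw [norm_real]

theorem isBigO_exp_neg_mul (w : ℂ) :
    (fun t : ℝ => exp (-w * t)) =O[atTop] fun t => Real.exp (-w.re * t) := by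
  refine IsBigO.of_bound 1 (Eventually.of_forall fun t => ?_)
  rw [norm_exp, one_mul, Real.norm_of_nonneg (Real.exp_pos _).le]
  simp

theorem SubExp.mul_exp_isBigO {ψ : ℝ → ℂ} (hψ : SubExp ψ) {w : ℂ} {b : ℝ} (hb : b < w.re) :
    (fun t => ψ t * exp (-w * t)) =O[atTop] fun t => Real.exp (-b * t) := by
  refine ((hψ (w.re - b) (by linarith)).mul (isBigO_exp_neg_mul w)).congr_right fun t => ?_
  rw [← Real.exp_add]
  ring_nf

theorem SubExp.integrableOn {ψ : ℝ → ℂ} (hψ : SubExp ψ) {w : ℂ} (hw : 0 < w.re) {ρ : ℝ}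
    (hc : ContinuousOn ψ (Ici ρ)) : IntegrableOn (fun t => ψ t * exp (-w * t)) (Ioi ρ) := by
  have hc' : ContinuousOn (fun t => ψ t * exp (-w * t)) (Ici ρ) :=
    hc.mul (by fun_prop)
  refine (integrable_norm_iff
    ((hc'.mono Ioi_subset_Ici_self).aestronglyMeasurable measurableSet_Ioi)).1 ?_
  exact integrable_of_isBigO_exp_neg (b := w.re / 2) (by positivity) hc'.norm
    (hψ.mul_exp_isBigO (by linarith)).norm_left

/-! ### The generating function on the half-line, and independence of the radius. -/

section
variable {r : ℕ} {ω : Fin r → ℂ}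

theorem one_sub_exp_ne_zero_of_re_pos {c : ℂ} (hc : 0 < c.re) {t : ℝ} (ht : 0 < t) :
    1 - exp (-c * t) ≠ 0 := by
  intro h
  have h1 := congrArg norm (sub_eq_zero.1 h)
  rw [norm_one, norm_exp] at h1
  have : (-c * (t : ℂ)).re = -(c.re * t) := by simp
  rw [this] at h1
  have := Real.exp_lt_one_iff.2 (neg_lt_zero.2 (mul_pos hc ht))
  linarith

theorem norm_one_sub_exp_inv_le {c : ℂ} (hc : 0 < c.re) {ρ t : ℝ} (hρ : 0 < ρ) (ht : ρ ≤ t) :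
    ‖(1 - exp (-c * t))⁻¹‖ ≤ (1 - Real.exp (-(c.re * ρ)))⁻¹ := by
  have h1 : 0 < 1 - Real.exp (-(c.re * ρ)) :=
    sub_pos.2 (Real.exp_lt_one_iff.2 (neg_lt_zero.2 (mul_pos hc hρ)))
  rw [norm_inv]
  refine inv_anti₀ h1 ?_
  have h2 := norm_sub_norm_le (1 : ℂ) (exp (-c * t))
  have h3 : (-c * (t : ℂ)).re = -(c.re * t) := by simp
  rw [norm_one, norm_exp, h3] at h2
  have h4 : Real.exp (-(c.re * t)) ≤ Real.exp (-(c.re * ρ)) := by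
    apply Real.exp_le_exp.2
    nlinarith
  linarith

theorem continuousOn_one_sub_exp_inv {c : ℂ} (hc : 0 < c.re) :
    ContinuousOn (fun t : ℝ => (1 - exp (-c * t))⁻¹) (Ioi 0) :=
  ContinuousOn.inv₀ (by fun_prop) fun _ ht => one_sub_exp_ne_zero_of_re_pos hc ht

theorem subExp_one_sub_exp_inv {c : ℂ} (hc : 0 < c.re) :
    SubExp fun t : ℝ => (1 - exp (-c * t))⁻¹ := by
  refine .of_isBigO_one (IsBigO.of_bound (1 - Real.exp (-(c.re * 1)))⁻¹ ?_)
  filter_upwards [eventually_ge_atTop 1] with t ht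
  simpa using norm_one_sub_exp_inv_le hc one_pos ht

theorem SubExp.prod {ι : Type*} (s : Finset ι) {φ : ι → ℝ → ℂ} (h : ∀ i ∈ s, SubExp (φ i)) :
    SubExp fun t => ∏ i ∈ s, φ i t := by
  classical
  induction s using Finset.induction_on with
  | empty => simpa using SubExp.const 1
  | insert i s hi ih =>
    simp only [Finset.prod_insert hi]
    exact (h i (by simp)).mul (ih fun j hj => h j (Finset.mem_insert_of_mem hj))

theorem continuousOn_genFun (hω : ∀ j, 0 < (ω j).re) :
    ContinuousOn (fun t : ℝ => genFun ω t) (Ioi 0) :=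
  continuousOn_finsetProd _ fun j _ => continuousOn_one_sub_exp_inv (hω j)

theorem subExp_genFun (hω : ∀ j, 0 < (ω j).re) : SubExp fun t : ℝ => genFun ω t :=
  SubExp.prod _ fun j _ => subExp_one_sub_exp_inv (hω j)

theorem continuousOn_ofReal_zpow (m : ℤ) : ContinuousOn (fun t : ℝ => (t : ℂ) ^ m) (Ioi 0) :=
  (continuous_ofReal.continuousOn).zpow₀ m fun _ ht => Or.inl (ofReal_ne_zero.2 (ne_of_gt ht))

theorem continuousOn_ofReal_log : ContinuousOn (fun t : ℝ => (Real.log t : ℂ)) (Ioi 0) :=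
  continuous_ofReal.comp_continuousOn (Real.continuousOn_log.mono fun _ ht => ne_of_gt ht)

theorem Ici_subset_Ioi_zero {ρ : ℝ} (hρ : 0 < ρ) : Ici ρ ⊆ Ioi 0 :=
  fun _ ht => hρ.trans_le ht

theorem integrableOn_genFun (hω : ∀ j, 0 < (ω j).re) {w : ℂ} (hw : 0 < w.re) (m : ℤ)
    {ρ : ℝ} (hρ : 0 < ρ) :
    IntegrableOn (fun t : ℝ => genFun ω t * exp (-w * t) * (t : ℂ) ^ m) (Ioi ρ) := by
  have h := ((subExp_genFun hω).mul (SubExp.zpow m)).integrableOn hw (ρ := ρ)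
    (((continuousOn_genFun hω).mul (continuousOn_ofReal_zpow m)).mono (Ici_subset_Ioi_zero hρ))
  exact h.congr_fun (fun t _ => by ring) measurableSet_Ioi

theorem integrableOn_genFun_log (hω : ∀ j, 0 < (ω j).re) {w : ℂ} (hw : 0 < w.re) (m : ℤ)
    {ρ : ℝ} (hρ : 0 < ρ) :
    IntegrableOn (fun t : ℝ => genFun ω t * exp (-w * t) * (t : ℂ) ^ m * (Real.log t : ℂ))
      (Ioi ρ) := by
  have h := (((subExp_genFun hω).mul (SubExp.zpow m)).mul SubExp.log).integrableOn hw (ρ := ρ)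
    ((((continuousOn_genFun hω).mul (continuousOn_ofReal_zpow m)).mul
      continuousOn_ofReal_log).mono (Ici_subset_Ioi_zero hρ))
  exact h.congr_fun (fun t _ => by ring) measurableSet_Ioi

/-- The incoming and outgoing half-lines carry `log x` with opposite signs, so only the increment
`2πi` of the logarithm survives. Both integrability hypotheses are needed to split the outgoing
integral. -/
theorem hankelLogIntegral_eq {G : ℂ → ℂ} {ρ : ℝ}
    (h₁ : IntegrableOn (fun t : ℝ => G t) (Ioi ρ))
    (h₂ : IntegrableOn (fun t : ℝ => G t * (Real.log t : ℂ)) (Ioi ρ)) :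
    hankelLogIntegral ρ G
      = 2 * Real.pi * I * (∫ t in Ioi ρ, G (t : ℂ)) + arcIntegral G (fun z => z) ρ := by
  have h : ∫ x in Ioi ρ, G (x : ℂ) * ((Real.log x : ℂ) + 2 * Real.pi * I)
      = (∫ x in Ioi ρ, G (x : ℂ) * (Real.log x : ℂ))
        + (∫ x in Ioi ρ, G (x : ℂ)) * (2 * Real.pi * I) := by
    simp only [mul_add (G _)]
    rw [integral_add h₂ (h₁.mul_const _), integral_mul_const]
  rw [hankelLogIntegral, h, arcIntegral]
  ring

theorem modifiedGamma_eq (hω : ∀ j, 0 < (ω j).re) {w : ℂ} (hw : 0 < w.re) (k : ℤ)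
    {ρ : ℝ} (hρ : 0 < ρ) :
    modifiedGamma ρ ω k w =
      (∫ t in Ioi ρ, genFun ω t * exp (-w * t) * (t : ℂ) ^ (-k - 1))
      + 1 / (2 * Real.pi * I) *
        arcIntegral (fun t => genFun ω t * exp (-w * t) * t ^ (-k - 1)) (fun z => z) ρ
      + (Real.eulerMascheroniConstant - Real.pi * I) * multipleBernoulli ω k w := by
  have h := hankelLogIntegral_eq (G := fun t => genFun ω t * exp (-w * t) * t ^ (-k - 1))
    (integrableOn_genFun hω hw (-k - 1) hρ) (integrableOn_genFun_log hω hw (-k - 1) hρ)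
  rw [modifiedGamma, h, mul_add, one_div, inv_mul_cancel_left₀ two_pi_I_ne_zero]

theorem cutJump_id (F : ℂ → ℂ) (t : ℝ) : cutJump F (fun z => z) t = F t * (2 * Real.pi * I) := by
  rw [cutJump]
  ring

theorem ne_zero_of_re (hω : ∀ j, 0 < (ω j).re) (j : Fin r) : ω j ≠ 0 := by
  rintro h
  have := hω j
  simp [h] at this

theorem exists_radius_of_isContourRadius {ρ : ℝ} (hρ : IsContourRadius ω ρ) :
    ∃ R, ρ < R ∧ ∀ j, R ≤ ‖(2 * Real.pi : ℂ) / ω j‖ := by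
  rcases isEmpty_or_nonempty (Fin r) with h | h
  · exact ⟨ρ + 1, by linarith, fun j => h.elim j⟩
  · exact ⟨Finset.univ.inf' Finset.univ_nonempty fun j => ‖(2 * Real.pi : ℂ) / ω j‖,
      (Finset.lt_inf'_iff _).2 fun j _ => hρ.2 j, fun j => Finset.inf'_le _ (Finset.mem_univ j)⟩

theorem differentiableOn_genFun (hω : ∀ j, ω j ≠ 0) {R : ℝ}
    (hR : ∀ j, R ≤ ‖(2 * Real.pi : ℂ) / ω j‖) :
    DifferentiableOn ℂ (genFun ω) (ball 0 R \ {0}) :=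
  DifferentiableOn.fun_finsetProd fun j _ => DifferentiableOn.inv (by fun_prop) fun _ ht =>
    one_sub_exp_ne_zero (hR j) (hω j) ht.2 (by simpa using ht.1)

theorem differentiableOn_genFun_mul (hω : ∀ j, ω j ≠ 0) {R : ℝ}
    (hR : ∀ j, R ≤ ‖(2 * Real.pi : ℂ) / ω j‖) (w : ℂ) (m : ℤ) :
    DifferentiableOn ℂ (fun t => genFun ω t * exp (-w * t) * t ^ m) (ball 0 R \ {0}) := by
  refine ((differentiableOn_genFun hω hR).mul (by fun_prop)).mul ?_
  exact fun t ht => (differentiableAt_zpow.2 (Or.inl ht.2)).differentiableWithinAt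

/-- The modified gamma function does not depend on the radius of the contour. -/
theorem modifiedGamma_eq_of_le (hω : ∀ j, 0 < (ω j).re) {w : ℂ} (hw : 0 < w.re) (k : ℤ)
    {ρ₁ ρ₂ : ℝ} (h₁ : 0 < ρ₁) (h₁₂ : ρ₁ ≤ ρ₂) (h₂ : IsContourRadius ω ρ₂) :
    modifiedGamma ρ₁ ω k w = modifiedGamma ρ₂ ω k w := by
  obtain ⟨R, hR₂, hR⟩ := exists_radius_of_isContourRadius h₂
  have hint := integrableOn_genFun hω hw (-k - 1) h₁
  have h := arcIntegral_sub (κ := fun z => z) (differentiableOn_genFun_mul (ne_zero_of_re hω) hR w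
    (-k - 1)) (by fun_prop) h₁ h₁₂ hR₂
  simp only [cutJump_id] at h
  rw [intervalIntegral.integral_mul_const] at h
  rw [modifiedGamma_eq hω hw k h₁, modifiedGamma_eq hω hw k h₂.1,
    ← intervalIntegral.integral_interval_add_Ioi hint
      (hint.mono_set (Ioi_subset_Ioi h₁₂)), ← sub_eq_iff_eq_add.1 h |>.symm]
  have := two_pi_I_ne_zero
  field_simp
  ring

theorem modifiedGamma_eq_modifiedGamma (hω : ∀ j, 0 < (ω j).re) {w : ℂ} (hw : 0 < w.re) (k : ℤ)
    {ρ₁ ρ₂ : ℝ} (h₁ : IsContourRadius ω ρ₁) (h₂ : IsContourRadius ω ρ₂) :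
    modifiedGamma ρ₁ ω k w = modifiedGamma ρ₂ ω k w := by
  rcases le_total ρ₁ ρ₂ with h | h
  · exact modifiedGamma_eq_of_le hω hw k h₁.1 h h₂
  · exact (modifiedGamma_eq_of_le hω hw k h₂.1 h h₁).symm

end

/-! ### Decay in `w` by integration by parts. -/

section
variable {r : ℕ} {ω : Fin r → ℂ}

/-- The derivative of `genFun ω` along the real axis. -/
def genFunDeriv (ω : Fin r → ℂ) (t : ℂ) : ℂ :=
  ∑ i, -ω i * ((∏ j ∈ Finset.univ.erase i, (1 - exp (-ω j * t))⁻¹)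
    * ((1 - exp (-ω i * t))⁻¹ * (1 - exp (-ω i * t))⁻¹)) * exp (-ω i * t)

theorem hasDerivAt_genFun (hω : ∀ j, 0 < (ω j).re) {t : ℝ} (ht : 0 < t) :
    HasDerivAt (fun t : ℝ => genFun ω t) (genFunDeriv ω t) t := by
  have h1 : ∀ j, HasDerivAt (fun t : ℂ => (1 - exp (-ω j * t))⁻¹)
      (-(-(exp (-ω j * t) * (-ω j * 1))) / (1 - exp (-ω j * t)) ^ 2) (t : ℂ) := fun j =>
    ((((hasDerivAt_id (t : ℂ)).const_mul (-ω j)).cexp).const_sub 1).inv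
      (one_sub_exp_ne_zero_of_re_pos (hω j) ht)
  have h2 := (HasDerivAt.fun_finsetProd (u := Finset.univ) fun j _ => h1 j).comp_ofReal
  convert! h2 using 1
  refine Finset.sum_congr rfl fun i _ => ?_
  rw [smul_eq_mul, div_eq_mul_inv, ← inv_pow]
  ring

theorem integrableOn_genFunDeriv (hω : ∀ j, 0 < (ω j).re) (m : ℤ) {ρ : ℝ} (hρ : 0 < ρ) :
    IntegrableOn (fun t : ℝ => genFunDeriv ω t * (t : ℂ) ^ m) (Ioi ρ) := by
  have : ∀ i, IntegrableOn (fun t : ℝ => (-ω i * ((∏ j ∈ Finset.univ.erase i,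
      (1 - exp (-ω j * t))⁻¹) * ((1 - exp (-ω i * t))⁻¹ * (1 - exp (-ω i * t))⁻¹))
        * (t : ℂ) ^ m) * exp (-ω i * t)) (Ioi ρ) := fun i => by
    refine SubExp.integrableOn (ψ := fun t : ℝ => -ω i * ((∏ j ∈ Finset.univ.erase i,
      (1 - exp (-ω j * t))⁻¹) * ((1 - exp (-ω i * t))⁻¹ * (1 - exp (-ω i * t))⁻¹))
        * (t : ℂ) ^ m) ?_ (hω i) ?_
    · exact ((SubExp.const _).mul ((SubExp.prod _ fun j _ => subExp_one_sub_exp_inv (hω j)).mul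
        ((subExp_one_sub_exp_inv (hω i)).mul (subExp_one_sub_exp_inv (hω i))))).mul
        (SubExp.zpow m)
    · refine ContinuousOn.mono ?_ (Ici_subset_Ioi_zero hρ)
      have hc := fun j => continuousOn_one_sub_exp_inv (hω j)
      exact (continuousOn_const.mul ((continuousOn_finsetProd _ fun j _ => hc j).mul
        ((hc i).mul (hc i)))).mul (continuousOn_ofReal_zpow m)
  refine (integrable_finsetSum Finset.univ fun i _ => this i).congr
    (Eventually.of_forall fun t => ?_)
  simp only [genFunDeriv, Finset.sum_mul]
  exact Finset.sum_congr rfl fun i _ => by ring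

theorem norm_exp_neg_mul_le_one {w : ℂ} (hw : 0 ≤ w.re) {t : ℝ} (ht : 0 ≤ t) :
    ‖exp (-w * t)‖ ≤ 1 := by
  rw [norm_exp]
  refine Real.exp_le_one_iff.2 ?_
  simpa using mul_nonneg hw ht

theorem norm_integral_mul_exp_le {φ : ℝ → ℂ} {ρ : ℝ} (hρ : 0 ≤ ρ)
    (hφ : IntegrableOn φ (Ioi ρ)) {w : ℂ} (hw : 0 ≤ w.re) :
    ‖∫ t in Ioi ρ, φ t * exp (-w * t)‖ ≤ ∫ t in Ioi ρ, ‖φ t‖ := by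
  refine norm_integral_le_of_norm_le hφ.norm ?_
  filter_upwards [ae_restrict_mem measurableSet_Ioi] with t ht
  rw [norm_mul]
  exact mul_le_of_le_one_right (norm_nonneg _)
    (norm_exp_neg_mul_le_one hw (hρ.trans (le_of_lt ht)))

theorem integrableOn_mul_exp {φ : ℝ → ℂ} {ρ : ℝ} (hρ : 0 ≤ ρ)
    (hφ : IntegrableOn φ (Ioi ρ)) {w : ℂ} (hw : 0 ≤ w.re) :
    IntegrableOn (fun t => φ t * exp (-w * t)) (Ioi ρ) := by
  refine Integrable.mul_bdd (c := 1) hφ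
    ((by fun_prop : Continuous fun t : ℝ => exp (-w * t)).aestronglyMeasurable) ?_
  filter_upwards [ae_restrict_mem measurableSet_Ioi] with t ht
  exact norm_exp_neg_mul_le_one hw (hρ.trans (le_of_lt ht))

/-- The integral of `f_ω(t) e^{-wt} t ^ m` over the half-line from `ρ` to `∞`. -/
def tailIntegral (ω : Fin r → ℂ) (ρ : ℝ) (m : ℤ) (w : ℂ) : ℂ :=
  ∫ t in Ioi ρ, genFun ω t * exp (-w * t) * (t : ℂ) ^ m

/-- Integration by parts against `e^{-wt}`: a factor `w` is gained and the power of `t` drops by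
one. The term with `f_ω'` is harmless, since `f_ω'` decays exponentially. -/
theorem mul_tailIntegral (hω : ∀ j, 0 < (ω j).re) {ρ : ℝ} (hρ : 0 < ρ) (m : ℤ) {w : ℂ}
    (hw : 0 < w.re) :
    w * tailIntegral ω ρ m w = genFun ω ρ * exp (-w * ρ) * (ρ : ℂ) ^ m
      + m * tailIntegral ω ρ (m - 1) w
      + ∫ t in Ioi ρ, genFunDeriv ω t * (t : ℂ) ^ m * exp (-w * t) := by
  have h1 := (integrableOn_genFun hω hw m hρ).const_mul (-w)
  have h2 := (integrableOn_genFun hω hw (m - 1) hρ).const_mul (m : ℂ)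
  have h3 := integrableOn_mul_exp hρ.le (integrableOn_genFunDeriv hω m hρ) hw.le
  have hderiv : ∀ t ∈ Ici ρ, HasDerivAt (fun t : ℝ => genFun ω t * exp (-w * t) * (t : ℂ) ^ m)
      (-w * (genFun ω t * exp (-w * t) * (t : ℂ) ^ m)
        + m * (genFun ω t * exp (-w * t) * (t : ℂ) ^ (m - 1))
        + genFunDeriv ω t * (t : ℂ) ^ m * exp (-w * t)) t := fun t ht => by
    have ht0 : 0 < t := hρ.trans_le ht
    have e1 := ((((hasDerivAt_id (t : ℂ)).const_mul (-w)).cexp)).comp_ofReal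
    have e2 := (hasDerivAt_zpow m (t : ℂ) (Or.inl (ofReal_ne_zero.2 ht0.ne'))).comp_ofReal
    convert! ((hasDerivAt_genFun hω ht0).mul e1).mul e2 using 1
    simp only [id, Pi.mul_apply]
    ring
  have hlim : Tendsto (fun t : ℝ => genFun ω t * exp (-w * t) * (t : ℂ) ^ m) atTop (𝓝 0) := by
    have := ((subExp_genFun hω).mul (SubExp.zpow m)).mul_exp_isBigO
      (w := w) (b := w.re / 2) (by linarith)
    refine (this.congr_left fun t => ?_).trans_tendsto ?_
    · ring
    · exact Real.tendsto_exp_atBot.comp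
        (tendsto_id.const_mul_atTop_of_neg (by linarith))
  have h := integral_Ioi_of_hasDerivAt_of_tendsto' hderiv ((h1.add h2).add h3) hlim
  have h' := integral_add (h1.add h2) h3
  simp only [Pi.add_apply] at h'
  rw [h', integral_add h1 h2, integral_const_mul, integral_const_mul] at h
  rw [tailIntegral, tailIntegral]
  linear_combination -h

theorem exists_norm_genFun_le (hω : ∀ j, 0 < (ω j).re) {ρ : ℝ} (hρ : 0 < ρ) :
    ∃ B, ∀ t : ℝ, ρ ≤ t → ‖genFun ω t‖ ≤ B := by
  refine ⟨∏ j, (1 - Real.exp (-((ω j).re * ρ)))⁻¹, fun t ht => ?_⟩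
  rw [genFun, norm_prod]
  exact Finset.prod_le_prod (fun _ _ => norm_nonneg _)
    fun j _ => norm_one_sub_exp_inv_le (hω j) hρ ht

/-- Here `t^m` is itself integrable at infinity, so no decay of `e^{-wt}` is needed and the bound is
uniform as `Re w → 0`. -/
theorem exists_norm_tailIntegral_le_of_le (hω : ∀ j, 0 < (ω j).re) {ρ : ℝ} (hρ : 0 < ρ)
    {m : ℤ} (hm : m ≤ -2) :
    ∃ K, ∀ w : ℂ, 0 < w.re → ‖tailIntegral ω ρ m w‖ ≤ K := by
  obtain ⟨B, hB⟩ := exists_norm_genFun_le hω hρ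
  have hz : IntegrableOn (fun t : ℝ => (t : ℂ) ^ m) (Ioi ρ) := by
    have h := integrableOn_Ioi_rpow_of_lt (a := m) (by exact_mod_cast (by omega : m < -1)) hρ
    refine IntegrableOn.congr_fun (Integrable.ofReal h) (fun t ht => ?_) measurableSet_Ioi
    simp [Real.rpow_intCast]
  have hφ : IntegrableOn (fun t : ℝ => genFun ω t * (t : ℂ) ^ m) (Ioi ρ) := by
    refine Integrable.bdd_mul (c := B) hz (((continuousOn_genFun hω).mono
      (Ioi_subset_Ioi hρ.le)).aestronglyMeasurable measurableSet_Ioi) ?_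
    filter_upwards [ae_restrict_mem measurableSet_Ioi] with t ht
    exact hB t (le_of_lt ht)
  refine ⟨∫ t in Ioi ρ, ‖genFun ω t * (t : ℂ) ^ m‖, fun w hw => ?_⟩
  have := norm_integral_mul_exp_le hρ.le hφ hw.le
  refine le_trans (le_of_eq ?_) this
  rw [tailIntegral]
  congr 2
  ext t
  ring

theorem exists_norm_tailIntegral_le_div (hω : ∀ j, 0 < (ω j).re) {ρ : ℝ} (hρ : 0 < ρ) {m : ℤ}
    (h : ∃ K, ∀ w : ℂ, 0 < w.re → 1 ≤ ‖w‖ → ‖tailIntegral ω ρ (m - 1) w‖ ≤ K) :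
    ∃ K, ∀ w : ℂ, 0 < w.re → 1 ≤ ‖w‖ → ‖tailIntegral ω ρ m w‖ ≤ K / ‖w‖ := by
  obtain ⟨K, hK⟩ := h
  refine ⟨‖genFun ω ρ * (ρ : ℂ) ^ m‖ + ‖(m : ℂ)‖ * K
    + ∫ t in Ioi ρ, ‖genFunDeriv ω t * (t : ℂ) ^ m‖, fun w hw hw1 => ?_⟩
  rw [le_div_iff₀ (by linarith), mul_comm, ← norm_mul, mul_tailIntegral hω hρ m hw]
  refine (norm_add₃_le).trans ?_
  gcongr
  · rw [mul_right_comm, norm_mul]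
    exact mul_le_of_le_one_right (norm_nonneg _) (norm_exp_neg_mul_le_one hw.le hρ.le)
  · rw [norm_mul]
    gcongr
    exact hK w hw hw1
  · exact norm_integral_mul_exp_le hρ.le (integrableOn_genFunDeriv hω m hρ) hw.le

/-- For `m > -2`, induction upwards from `-2`: each integration by parts reduces `m` to `m - 1`, and
the gained `1/‖w‖` is discarded because `‖w‖ ≥ 1`. -/
theorem exists_norm_tailIntegral_le (hω : ∀ j, 0 < (ω j).re) {ρ : ℝ} (hρ : 0 < ρ) (m : ℤ) :
    ∃ K, ∀ w : ℂ, 0 < w.re → 1 ≤ ‖w‖ → ‖tailIntegral ω ρ m w‖ ≤ K := by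
  rcases le_total m (-2) with hm | hm
  · obtain ⟨K, hK⟩ := exists_norm_tailIntegral_le_of_le hω hρ hm
    exact ⟨K, fun w hw _ => hK w hw⟩
  · induction m, hm using Int.leInduction with
    | base =>
      obtain ⟨K, hK⟩ := exists_norm_tailIntegral_le_of_le hω hρ (le_refl (-2))
      exact ⟨K, fun w hw _ => hK w hw⟩
    | succ m hm ih =>
      obtain ⟨K, hK⟩ := exists_norm_tailIntegral_le_div hω hρ (m := m + 1) (by simpa using ih)
      refine ⟨K, fun w hw hw1 => (hK w hw hw1).trans ?_⟩
      have hK0 : 0 ≤ K := by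
        have := (norm_nonneg _).trans (hK w hw hw1)
        rwa [le_div_iff₀ (by linarith), zero_mul] at this
      exact div_le_self hK0 hw1

theorem eventually_atInfinity (a : ℂ) (C : ℝ) :
    ∀ᶠ w in atInfinity a, 0 < w.re ∧ 0 < (w + a).re ∧ C ≤ ‖w‖ := by
  rw [atInfinity, eventually_inf_principal]
  filter_upwards [tendsto_norm_cobounded_atTop.eventually_ge_atTop C] with w hw h
  exact ⟨h.1, h.2, hw⟩

theorem tailIntegral_isBigO (hω : ∀ j, 0 < (ω j).re) {ρ : ℝ} (hρ : 0 < ρ) (m : ℤ) (a : ℂ) :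
    tailIntegral ω ρ m =O[atInfinity a] fun w => 1 / w := by
  obtain ⟨K, hK⟩ := exists_norm_tailIntegral_le_div hω hρ
    (exists_norm_tailIntegral_le hω hρ (m - 1))
  refine IsBigO.of_bound K ?_
  filter_upwards [eventually_atInfinity a 1] with w hw
  rw [norm_div, norm_one, mul_one_div]
  exact hK w hw.1 hw.2.2

theorem tailIntegral_add_isBigO (hω : ∀ j, 0 < (ω j).re) {ρ : ℝ} (hρ : 0 < ρ) (m : ℤ) (a : ℂ) :
    (fun w => tailIntegral ω ρ m (w + a)) =O[atInfinity a] fun w => 1 / w := by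
  obtain ⟨K, hK⟩ := exists_norm_tailIntegral_le_div hω hρ
    (exists_norm_tailIntegral_le hω hρ (m - 1))
  refine IsBigO.of_bound (2 * K) ?_
  -- This threshold gives `‖w + a‖ ≥ ‖w‖ / 2 ≥ 1`; hence the constant `2 * K`.
  filter_upwards [eventually_atInfinity a (2 * ‖a‖ + 2)] with w hw
  have h1 : ‖w‖ - ‖a‖ ≤ ‖w + a‖ := by
    simpa using norm_sub_norm_le w (-a)
  have h2 : ‖w‖ / 2 ≤ ‖w + a‖ := by linarith [hw.2.2, norm_nonneg a]
  have h3 : 1 ≤ ‖w + a‖ := by linarith [hw.2.2, norm_nonneg a]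
  have h4 := hK _ hw.2.1 h3
  have hw0 : 0 < ‖w‖ := by linarith [hw.2.2, norm_nonneg a]
  have hK0 : 0 ≤ K := by
    have := (norm_nonneg _).trans h4
    rwa [le_div_iff₀ (by linarith), zero_mul] at this
  rw [norm_div, norm_one, mul_one_div]
  refine h4.trans ?_
  rw [div_le_div_iff₀ (by linarith) hw0]
  nlinarith

/-- One integration by parts suffices: `h` and `h'` are bounded on `[0, ρ]` and do not involve `w`,
while `|e^{-wt}| ≤ 1`. -/
theorem integral_mul_exp_isBigO {h : ℂ → ℂ} {R ρ : ℝ} (hh : DifferentiableOn ℂ h (ball 0 R))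
    (hρ : 0 < ρ) (hρR : ρ < R) (a : ℂ) :
    (fun w : ℂ => ∫ t in (0 : ℝ)..ρ, h t * exp (-w * t)) =O[atInfinity a] fun w => 1 / w := by
  have hmem : ∀ t ∈ uIcc 0 ρ, (t : ℂ) ∈ ball (0 : ℂ) R := fun t ht => by
    rw [uIcc_of_le hρ.le] at ht
    rw [mem_ball_zero_iff, norm_real, Real.norm_of_nonneg ht.1]
    exact ht.2.trans_lt hρR
  have hu : ∀ t ∈ uIcc 0 ρ, HasDerivAt (fun t : ℝ => h t) (deriv h t) t := fun t ht =>
    ((hh.differentiableAt (isOpen_ball.mem_nhds (hmem t ht))).hasDerivAt).comp_ofReal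
  have hu' : ContinuousOn (fun t : ℝ => deriv h t) (uIcc 0 ρ) :=
    (hh.deriv isOpen_ball).continuousOn.comp continuous_ofReal.continuousOn hmem
  refine IsBigO.of_bound (‖h ρ‖ + ‖h 0‖ + ∫ t in (0 : ℝ)..ρ, ‖deriv h t‖) ?_
  filter_upwards [eventually_atInfinity a 1] with w hw
  have hw0 : w ≠ 0 := norm_pos_iff.1 (by linarith [hw.2.2])
  have hv : ∀ t ∈ uIcc 0 ρ, HasDerivAt (fun t : ℝ => exp (-w * t)) (exp (-w * t) * (-w * 1)) t :=
    fun t _ => (((hasDerivAt_id (t : ℂ)).const_mul (-w)).cexp).comp_ofReal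
  have hparts := intervalIntegral.integral_mul_deriv_eq_deriv_mul hu hv hu'.intervalIntegrable
    ((by fun_prop : Continuous fun t : ℝ => exp (-w * t) * (-w * 1)).intervalIntegrable _ _)
  have e : ∫ t in (0 : ℝ)..ρ, h t * (exp (-w * t) * (-w * 1))
      = -w * ∫ t in (0 : ℝ)..ρ, h t * exp (-w * t) := by
    rw [← intervalIntegral.integral_const_mul]
    exact intervalIntegral.integral_congr fun t _ => by ring
  rw [e] at hparts
  have hb : ‖∫ t in (0 : ℝ)..ρ, deriv h t * exp (-w * t)‖ ≤ ∫ t in (0 : ℝ)..ρ, ‖deriv h t‖ := by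
    refine intervalIntegral.norm_integral_le_of_norm_le hρ.le (Eventually.of_forall fun t ht => ?_)
      hu'.norm.intervalIntegrable
    rw [norm_mul]
    exact mul_le_of_le_one_right (norm_nonneg _) (norm_exp_neg_mul_le_one hw.1.le ht.1.le)
  rw [norm_div, norm_one, mul_one_div, le_div_iff₀ (norm_pos_iff.2 hw0), mul_comm, ← norm_mul,
    ← norm_neg, ← neg_mul, hparts]
  refine (norm_sub_le _ _).trans (add_le_add ((norm_sub_le _ _).trans (add_le_add ?_ ?_)) hb)
  · rw [norm_mul]
    exact mul_le_of_le_one_right (norm_nonneg _) (norm_exp_neg_mul_le_one hw.1.le hρ.le)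
  · simp

end

/-- With a removable singularity at `0` the arc of radius `x` is `O(x (|log x| + 2π))`, so the
circle collapses onto the cut, where the logarithm jumps by `2πi`. The value of `F` at `0` is
irrelevant. -/
theorem arcIntegral_id_eq_integral {F h : ℂ → ℂ} {R ρ : ℝ}
    (hh : DifferentiableOn ℂ h (ball 0 R)) (hρ : 0 < ρ) (hρR : ρ < R)
    (hF : ∀ t : ℂ, t ≠ 0 → F t = h t) :
    arcIntegral F (fun z => z) ρ = 2 * Real.pi * I * ∫ t in (0 : ℝ)..ρ, h t := by
  have hsub : ∀ t ∈ Icc 0 ρ, (t : ℂ) ∈ ball (0 : ℂ) R := fun t ht => by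
    rw [mem_ball_zero_iff, norm_real, Real.norm_of_nonneg ht.1]
    exact ht.2.trans_lt hρR
  have hFd : DifferentiableOn ℂ F (ball 0 R \ {0}) :=
    (hh.mono sdiff_subset).congr fun t ht => hF t ht.2
  have hc : ContinuousOn (fun t : ℝ => h t * (2 * Real.pi * I)) (uIcc 0 ρ) := by
    rw [uIcc_of_le hρ.le]
    exact (hh.continuousOn.comp continuous_ofReal.continuousOn hsub).mul continuousOn_const
  have hjump : ∀ t ∈ uIoc 0 ρ, h t * (2 * Real.pi * I) = cutJump F (fun z => z) t := by
    intro t ht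
    rw [uIoc_of_le hρ.le] at ht
    rw [cutJump_id, hF t (ofReal_ne_zero.2 ht.1.ne')]
  obtain ⟨A, hA⟩ := (isCompact_closedBall (0 : ℂ) ρ).exists_bound_of_continuousOn
    (hh.continuousOn.mono (closedBall_subset_ball hρR))
  have hlim : Tendsto (arcIntegral F fun z => z) (𝓝[>] 0) (𝓝 0) := by
    refine squeeze_zero_norm' (a := fun x =>
      A * ((|Real.log x| + 2 * Real.pi) * x) * (2 * Real.pi)) ?_ ?_
    · filter_upwards [Ioc_mem_nhdsGT hρ] with x hx
      refine (norm_arcIntegral_le hx.1 (A := A) (B := |Real.log x| + 2 * Real.pi)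
        (fun t ht => ?_) fun θ hθ => ?_).trans_eq (by ring)
      · rw [hF t (norm_pos_iff.1 (by rw [ht]; exact hx.1))]
        exact hA t (by rw [mem_closedBall_zero_iff, ht]; exact hx.2)
      · refine (norm_add_le _ _).trans ?_
        rw [norm_mul, norm_I, mul_one, norm_real, norm_real, Real.norm_eq_abs,
          Real.norm_of_nonneg hθ.1]
        linarith [hθ.2]
    · have h1 : Tendsto (fun x : ℝ => |Real.log x * x|) (𝓝[>] 0) (𝓝 0) := by
        simpa using (tendsto_log_mul_rpow_nhdsGT_zero one_pos).abs
      have h2 : Tendsto (fun x : ℝ => 2 * Real.pi * x) (𝓝[>] 0) (𝓝 0) := by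
        have : Tendsto (fun x : ℝ => 2 * Real.pi * x) (𝓝 0) (𝓝 (2 * Real.pi * 0)) :=
          tendsto_id.const_mul _
        rw [mul_zero] at this
        exact this.mono_left nhdsWithin_le_nhds
      have h3 := ((h1.add h2).const_mul A).mul_const (2 * Real.pi)
      simp only [add_zero, mul_zero, zero_mul] at h3
      refine h3.congr' ?_
      filter_upwards [self_mem_nhdsWithin] with x hx
      have hx' : 0 < x := hx
      rw [abs_mul, abs_of_pos hx', add_mul]
  rw [arcIntegral_eq_integral hFd (by fun_prop) hρ hρR
    ((intervalIntegrable_congr hjump).1 hc.intervalIntegrable) hlim,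
    ← intervalIntegral.integral_congr_ae (Eventually.of_forall hjump),
    intervalIntegral.integral_mul_const, mul_comm]

theorem intervalIntegrable_arc {F κ : ℂ → ℂ} {R ρ : ℝ} (hF : ContinuousOn F (ball 0 R \ {0}))
    (hκ : Continuous κ) (hρ : 0 < ρ) (hρR : ρ < R) :
    IntervalIntegrable (fun θ : ℝ => F (ρ * exp (θ * I)) * κ ((Real.log ρ : ℂ) + θ * I)
      * (I * (ρ * exp (θ * I)))) volume 0 (2 * Real.pi) := by
  refine Continuous.intervalIntegrable ?_ _ _
  have h : Continuous fun θ : ℝ => F (ρ * exp (θ * I)) := by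
    refine hF.comp_continuous (by fun_prop) fun θ => ⟨?_, ?_⟩
    · rw [mem_ball_zero_iff, norm_mul, norm_exp_ofReal_mul_I, norm_real,
        Real.norm_of_nonneg hρ.le, mul_one]
      exact hρR
    · exact mul_ne_zero (ofReal_ne_zero.2 hρ.ne') (exp_ne_zero _)
  exact (h.mul (hκ.comp (by fun_prop))).mul (by fun_prop)

theorem arcIntegral_sub_sum {ι : Type*} (s : Finset ι) {F κ : ℂ → ℂ} {G : ι → ℂ → ℂ} (c : ι → ℂ)
    {R ρ : ℝ} (hF : ContinuousOn F (ball 0 R \ {0}))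
    (hG : ∀ i ∈ s, ContinuousOn (G i) (ball 0 R \ {0}))
    (hκ : Continuous κ) (hρ : 0 < ρ) (hρR : ρ < R) :
    arcIntegral (fun t => F t - ∑ i ∈ s, c i * G i t) κ ρ
      = arcIntegral F κ ρ - ∑ i ∈ s, c i * arcIntegral (G i) κ ρ := by
  simp only [arcIntegral, ← intervalIntegral.integral_const_mul]
  have hi := fun i hi => (intervalIntegrable_arc (hG i hi) hκ hρ hρR).const_mul (c i)
  rw [← intervalIntegral.integral_finsetSum hi, ← intervalIntegral.integral_sub
    (intervalIntegrable_arc hF hκ hρ hρR) (IntervalIntegrable.sum s hi |>.congr ?_)]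
  · refine intervalIntegral.integral_congr fun θ _ => ?_
    simp only [sub_mul, Finset.sum_mul, mul_assoc]
  · exact fun θ _ => by simp only [Finset.sum_apply]

/-! ### Comparison of the modified gamma functions of ranks `r + l` and `r`. -/

section
variable {r l : ℕ} {ω : Fin r → ℂ} {α : Fin l → ℂ}

theorem append_re_pos (hω : ∀ j, 0 < (ω j).re) (hα : ∀ j, 0 < (α j).re) :
    ∀ j, 0 < (Fin.append ω α j).re := by
  intro j
  refine Fin.addCases (fun i => ?_) (fun i => ?_) j
  · simpa using hω i
  · simpa using hα i

theorem isContourRadius_left {ρ : ℝ} (h : IsContourRadius (Fin.append ω α) ρ) :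
    IsContourRadius ω ρ :=
  ⟨h.1, fun j => by simpa using h.2 (Fin.castAdd l j)⟩

theorem genFun_append (t : ℂ) : genFun (Fin.append ω α) t = genFun ω t * genFun α t := by
  simp only [genFun, Fin.prod_univ_add, Fin.append_left, Fin.append_right]

/-- The Laurent remainder of `f_α(t) e^{-at}` is divisible by `t^{r+k+1}`; together with `t^{-k-1}`
this leaves `t^r`, which removes the pole of `f_ω`. The function `h` is chosen before `w`, which
makes the later estimate uniform. -/
theorem exists_holomorphic_difference (hω : ∀ j, 0 < (ω j).re) (hα : ∀ j, 0 < (α j).re) (a : ℂ)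
    {R : ℝ} (hR0 : 0 < R) (hR : ∀ j, R ≤ ‖(2 * Real.pi : ℂ) / Fin.append ω α j‖) {k : ℤ}
    (hk : -((r : ℤ) + l) ≤ k) :
    ∃ h : ℂ → ℂ, DifferentiableOn ℂ h (ball 0 R) ∧ ∀ w t : ℂ, t ≠ 0 →
      genFun (Fin.append ω α) t * exp (-(w + a) * t) * t ^ (-k - 1)
        - ∑ N ∈ Finset.Icc (-(l : ℤ)) ((r : ℤ) + k), multipleBernoulli α N a *
          (genFun ω t * exp (-w * t) * t ^ (-(k - N) - 1)) = h t * exp (-w * t) := by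
  have hRω : ∀ j, R ≤ ‖(2 * Real.pi : ℂ) / ω j‖ := fun j => by simpa using hR (Fin.castAdd l j)
  have hRα : ∀ j, R ≤ ‖(2 * Real.pi : ℂ) / α j‖ := fun j => by simpa using hR (Fin.natAdd r j)
  obtain ⟨h, hh, e⟩ := exists_laurent_remainder (ne_zero_of_re hα) hR0 hRα a ((r : ℤ) + k)
    (by linarith)
  refine ⟨fun t => regGenFun ω 0 t * h t,
    (differentiableOn_regGenFun (ne_zero_of_re hω) hRω 0).mul hh, fun w t ht => ?_⟩
  have e1 := e t ht
  have e2 := pow_mul_genFun_mul_exp (ω := ω) 0 ht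
  rw [neg_zero, zero_mul, exp_zero, mul_one] at e2
  have hexp : exp (-(w + a) * t) = exp (-w * t) * exp (-a * t) := by
    rw [← exp_add]; ring_nf
  have hpow : t ^ (-k - 1) * t ^ ((r : ℤ) + k + 1) = t ^ r := by
    rw [← zpow_add₀ ht, ← zpow_natCast]; congr 1; ring
  have hs : ∑ N ∈ Finset.Icc (-(l : ℤ)) ((r : ℤ) + k), multipleBernoulli α N a *
          (genFun ω t * exp (-w * t) * t ^ (-(k - N) - 1))
      = genFun ω t * exp (-w * t) * t ^ (-k - 1) *
        ∑ N ∈ Finset.Icc (-(l : ℤ)) ((r : ℤ) + k), multipleBernoulli α N a * t ^ N := by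
    rw [Finset.mul_sum]
    refine Finset.sum_congr rfl fun N _ => ?_
    rw [show -(k - N) - 1 = (-k - 1) + N by ring, zpow_add₀ ht]
    ring
  simp only
  rw [hs, genFun_append, hexp, ← e2, ← hpow]
  linear_combination genFun ω t * exp (-w * t) * t ^ (-k - 1) * e1

theorem modifiedGamma_append_isBigO (hω : ∀ j, 0 < (ω j).re) (hα : ∀ j, 0 < (α j).re) (a : ℂ)
    {ρ ρ' : ℝ} (hρ : IsContourRadius (Fin.append ω α) ρ) (hρ' : IsContourRadius ω ρ') {k : ℤ}
    (hk : -((r : ℤ) + l) ≤ k) :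
    (fun w : ℂ => modifiedGamma ρ (Fin.append ω α) k (w + a)
        - ∑ N ∈ Finset.Icc (-(l : ℤ)) ((r : ℤ) + k),
            multipleBernoulli α N a * modifiedGamma ρ' ω (k - N) w)
      =O[atInfinity a] (fun w : ℂ => 1 / w) := by
  have hωα := append_re_pos hω hα
  obtain ⟨R, hρR, hR⟩ := exists_radius_of_isContourRadius hρ
  have hR0 : 0 < R := hρ.1.trans hρR
  obtain ⟨h, hh, e⟩ := exists_holomorphic_difference hω hα a hR0 hR hk
  have hRω : ∀ j, R ≤ ‖(2 * Real.pi : ℂ) / ω j‖ := fun j => by simpa using hR (Fin.castAdd l j)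
  -- What is left after the Bernoulli terms cancel: the tails of both sides and the collapsed arc of
  -- the difference.
  have key : (fun w => tailIntegral (Fin.append ω α) ρ (-k - 1) (w + a)
      - (∑ N ∈ Finset.Icc (-(l : ℤ)) ((r : ℤ) + k),
          multipleBernoulli α N a * tailIntegral ω ρ (-(k - N) - 1) w)
      + ∫ t in (0 : ℝ)..ρ, h t * exp (-w * t)) =O[atInfinity a] (fun w : ℂ => 1 / w) :=
    ((tailIntegral_add_isBigO hωα hρ.1 _ a).sub
      (IsBigO.fun_sum fun N _ => (tailIntegral_isBigO hω hρ.1 _ a).const_mul_left _)).add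
      (integral_mul_exp_isBigO hh hρ.1 hρR a)
  refine key.congr' ?_ EventuallyEq.rfl
  filter_upwards [eventually_atInfinity a 0] with w hw
  have harc := arcIntegral_sub_sum (Finset.Icc (-(l : ℤ)) ((r : ℤ) + k))
    (κ := fun z => z) (fun N => multipleBernoulli α N a)
    (differentiableOn_genFun_mul (ne_zero_of_re hωα) hR (w + a) (-k - 1)).continuousOn
    (fun N _ => (differentiableOn_genFun_mul (ne_zero_of_re hω) hRω w
      (-(k - N) - 1)).continuousOn) continuous_id hρ.1 hρR
  rw [arcIntegral_id_eq_integral (hh.mul (by fun_prop : DifferentiableOn ℂ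
    (fun t => exp (-w * t)) (ball 0 R))) hρ.1 hρR (e w)] at harc
  have hsum : ∑ N ∈ Finset.Icc (-(l : ℤ)) ((r : ℤ) + k),
      multipleBernoulli α N a * modifiedGamma ρ' ω (k - N) w
      = (∑ N ∈ Finset.Icc (-(l : ℤ)) ((r : ℤ) + k),
          multipleBernoulli α N a * tailIntegral ω ρ (-(k - N) - 1) w)
        + 1 / (2 * Real.pi * I) * (∑ N ∈ Finset.Icc (-(l : ℤ)) ((r : ℤ) + k),
          multipleBernoulli α N a * arcIntegral
            (fun t => genFun ω t * exp (-w * t) * t ^ (-(k - N) - 1)) (fun z => z) ρ)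
        + (Real.eulerMascheroniConstant - Real.pi * I) *
          ∑ N ∈ Finset.Icc (-(l : ℤ)) ((r : ℤ) + k),
            multipleBernoulli α N a * multipleBernoulli ω (k - N) w := by
    rw [Finset.mul_sum, Finset.mul_sum, ← Finset.sum_add_distrib, ← Finset.sum_add_distrib]
    refine Finset.sum_congr rfl fun N _ => ?_
    rw [modifiedGamma_eq_modifiedGamma hω hw.1 _ hρ' (isContourRadius_left hρ),
      modifiedGamma_eq hω hw.1 _ hρ.1, tailIntegral]
    ring
  rw [hsum, modifiedGamma_eq hωα hw.2.1 k hρ.1,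
    multipleBernoulli_append (ne_zero_of_re hω) (ne_zero_of_re hα) w a k hk]
  simp only [Pi.mul_apply] at harc
  have hpi := two_pi_I_ne_zero
  have : ∫ t in (0 : ℝ)..ρ, h t * exp (-w * t) = 1 / (2 * Real.pi * I) *
      (2 * Real.pi * I * ∫ t in (0 : ℝ)..ρ, h t * exp (-w * t)) := by
    field_simp
  rw [this, harc, tailIntegral]
  ring

end

/-! ### The Mellin transform of the generating function and the zeta series. -/

section
variable {r : ℕ} {ω : Fin r → ℂ}

theorem continuousOn_genFun_mul_exp (hω : ∀ j, 0 < (ω j).re) (w : ℂ) :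
    ContinuousOn (fun t : ℝ => genFun ω t * exp (-w * t)) (Ioi 0) :=
  (continuousOn_genFun hω).mul (by fun_prop)

theorem exists_norm_genFun_mul_exp_le (hω : ∀ j, ω j ≠ 0) (w : ℂ) :
    ∃ A R : ℝ, 0 < R ∧ ∀ t : ℂ, t ≠ 0 → ‖t‖ ≤ R →
      ‖genFun ω t * exp (-w * t)‖ ≤ A * ‖t‖ ^ (-(r : ℝ)) := by
  obtain ⟨R, hR0, hR⟩ := exists_pos_radius hω
  obtain ⟨A, hA⟩ := (isCompact_closedBall (0 : ℂ) (R / 2)).exists_bound_of_continuousOn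
    ((differentiableOn_regGenFun hω hR w).continuousOn.mono
      (closedBall_subset_ball (by linarith)))
  refine ⟨A, R / 2, by linarith, fun t ht htR => ?_⟩
  have h := hA t (mem_closedBall_zero_iff.2 htR)
  have ht' : 0 < ‖t‖ := norm_pos_iff.2 ht
  rw [← pow_mul_genFun_mul_exp w ht, norm_mul, norm_pow] at h
  rw [Real.rpow_neg ht'.le, Real.rpow_natCast, ← div_eq_mul_inv, le_div_iff₀ (by positivity),
    mul_comm]
  exact h

theorem genFun_mul_exp_isBigO_zero (hω : ∀ j, ω j ≠ 0) (w : ℂ) :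
    (fun t : ℝ => genFun ω t * exp (-w * t)) =O[𝓝[>] 0] fun t => t ^ (-(r : ℝ)) := by
  obtain ⟨A, R, hR, hA⟩ := exists_norm_genFun_mul_exp_le hω w
  refine IsBigO.of_bound A ?_
  filter_upwards [Ioc_mem_nhdsGT hR] with t ht
  have e : ‖(t : ℂ)‖ = t := by rw [norm_real, Real.norm_of_nonneg ht.1.le]
  have := hA t (ofReal_ne_zero.2 ht.1.ne') (e.trans_le ht.2)
  rw [e] at this
  rwa [Real.norm_of_nonneg (Real.rpow_nonneg ht.1.le _)]

theorem mellinConvergent_genFun (hω : ∀ j, 0 < (ω j).re) {w : ℂ} (hw : 0 < w.re) {s : ℂ}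
    (hs : (r : ℝ) < s.re) : MellinConvergent (fun t : ℝ => genFun ω t * exp (-w * t)) s :=
  mellinConvergent_of_isBigO_rpow_exp (a := w.re / 2) (by positivity)
    ((continuousOn_genFun_mul_exp hω w).locallyIntegrableOn measurableSet_Ioi)
    ((subExp_genFun hω).mul_exp_isBigO (by linarith))
    (genFun_mul_exp_isBigO_zero (ne_zero_of_re hω) w) hs

theorem differentiableAt_mellin_genFun (hω : ∀ j, 0 < (ω j).re) {w : ℂ} (hw : 0 < w.re) {s : ℂ}
    (hs : (r : ℝ) < s.re) :
    DifferentiableAt ℂ (mellin fun t : ℝ => genFun ω t * exp (-w * t)) s :=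
  mellin_differentiableAt_of_isBigO_rpow_exp (a := w.re / 2) (by positivity)
    ((continuousOn_genFun_mul_exp hω w).locallyIntegrableOn measurableSet_Ioi)
    ((subExp_genFun hω).mul_exp_isBigO (by linarith))
    (genFun_mul_exp_isBigO_zero (ne_zero_of_re hω) w) hs

end

theorem integrableOn_cpow_mul_exp {s c : ℂ} (hs : 0 < s.re) (hc : 0 < c.re) :
    IntegrableOn (fun t : ℝ => (t : ℂ) ^ (s - 1) * exp (-c * t)) (Ioi 0) := by
  -- In rank `0` the generating function is `1`, and its Mellin integral is Euler's.
  have h := mellinConvergent_genFun (ω := (Fin.elim0 : Fin 0 → ℂ)) (fun j => j.elim0) hc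
    (s := s) (by simpa using hs)
  simpa [MellinConvergent, genFun] using h

theorem continuousOn_ofReal_cpow (s : ℂ) : ContinuousOn (fun t : ℝ => (t : ℂ) ^ s) (Ioi 0) :=
  fun t ht => (continuousAt_ofReal_cpow_const t s (Or.inr (ne_of_gt ht))).continuousWithinAt

theorem norm_ofReal_cpow_mul_exp {s c : ℂ} {t : ℝ} (ht : 0 < t) :
    ‖(t : ℂ) ^ s * exp (-c * t)‖ = t ^ s.re * Real.exp (-(c.re * t)) := by
  rw [norm_mul, norm_cpow_eq_rpow_re_of_pos ht, norm_exp]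
  simp

theorem differentiableAt_integral_cpow_mul_exp {s c : ℂ} (hs : 0 < s.re) (hc : 0 < c.re) :
    DifferentiableAt ℂ (fun c : ℂ => ∫ t in Ioi (0 : ℝ), (t : ℂ) ^ (s - 1) * exp (-c * t)) c := by
  have hmeas : ∀ z : ℂ, AEStronglyMeasurable (fun t : ℝ => (t : ℂ) ^ (s - 1) * exp (-z * t))
      (volume.restrict (Ioi 0)) := fun z =>
    ((continuousOn_ofReal_cpow _).mul (by fun_prop)).aestronglyMeasurable measurableSet_Ioi
  have hmeas' : AEStronglyMeasurable (fun t : ℝ => (t : ℂ) ^ (s - 1) * (exp (-c * t) * -t))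
      (volume.restrict (Ioi 0)) :=
    ((continuousOn_ofReal_cpow _).mul (by fun_prop)).aestronglyMeasurable measurableSet_Ioi
  -- Dominating function: differentiating in `c` costs a factor `t`, hence `s + 1`; on the ball of
  -- radius `c.re / 2` the real part stays above `c.re / 2`.
  have hb := (integrableOn_cpow_mul_exp (s := s + 1) (c := c / 2) (by
    rw [add_re, one_re]; linarith) (by rw [div_ofNat_re]; linarith)).norm
  refine (hasDerivAt_integral_of_dominated_loc_of_deriv_le (μ := volume.restrict (Ioi 0))
    (F := fun (z : ℂ) (t : ℝ) => (t : ℂ) ^ (s - 1) * exp (-z * t))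
    (F' := fun (z : ℂ) (t : ℝ) => (t : ℂ) ^ (s - 1) * (exp (-z * t) * -t))
    (ball_mem_nhds c (half_pos hc)) (Eventually.of_forall hmeas)
    (integrableOn_cpow_mul_exp hs hc) hmeas' ?_ hb ?_).2.differentiableAt
  · filter_upwards [ae_restrict_mem measurableSet_Ioi] with t ht z hz
    have ht' : (0 : ℝ) < t := ht
    have hz' : c.re / 2 ≤ z.re := by
      have h1 := (abs_re_le_norm (z - c)).trans_lt (mem_ball_iff_norm.1 hz)
      rw [sub_re] at h1
      linarith [(abs_lt.1 h1).1]
    rw [add_sub_cancel_right, norm_ofReal_cpow_mul_exp ht', ← mul_assoc, norm_mul,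
      norm_ofReal_cpow_mul_exp ht', norm_neg, norm_real, Real.norm_of_nonneg ht'.le, mul_right_comm,
      sub_re, one_re, Real.rpow_sub_one ht'.ne', div_mul_cancel₀ _ ht'.ne', div_ofNat_re]
    gcongr
  · refine Eventually.of_forall fun t z _ => ?_
    have h := (((hasDerivAt_id z).neg.mul_const (t : ℂ)).cexp).const_mul ((t : ℂ) ^ (s - 1))
    simpa using h

/-- Euler's integral with a complex scaling factor. -/
theorem integral_cpow_mul_exp {s c : ℂ} (hs : 0 < s.re) (hc : 0 < c.re) :
    ∫ t in Ioi (0 : ℝ), (t : ℂ) ^ (s - 1) * exp (-c * t) = Gamma s * c ^ (-s) := by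
  have hopen : IsOpen {z : ℂ | 0 < z.re} := isOpen_lt continuous_const continuous_re
  have h1 : AnalyticOnNhd ℂ (fun c : ℂ => ∫ t in Ioi (0 : ℝ), (t : ℂ) ^ (s - 1) * exp (-c * t))
      {z : ℂ | 0 < z.re} :=
    DifferentiableOn.analyticOnNhd (fun z hz =>
      (differentiableAt_integral_cpow_mul_exp hs hz).differentiableWithinAt) hopen
  have h2 : AnalyticOnNhd ℂ (fun c : ℂ => Gamma s * c ^ (-s)) {z : ℂ | 0 < z.re} :=
    DifferentiableOn.analyticOnNhd (fun z hz => ((differentiableAt_id.cpow_const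
      (Or.inl hz)).const_mul _).differentiableWithinAt) hopen
  -- Identity theorem on the right half-plane: the formula is known for real `c > 0`, and the real
  -- points to the right of `1` accumulate at `1`.
  refine h1.eqOn_of_preconnected_of_frequently_eq h2
    (convex_halfSpace_re_gt 0).isPreconnected (z₀ := 1) (by simp) ?_ hc
  have hseq : Tendsto (fun x : ℝ => (x : ℂ)) (𝓝[>] 1) (𝓝[≠] 1) := by
    refine tendsto_nhdsWithin_iff.2 ⟨?_, ?_⟩
    · exact (continuous_ofReal.tendsto' 1 1 (by simp)).mono_left nhdsWithin_le_nhds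
    · filter_upwards [self_mem_nhdsWithin] with x hx
      simpa using ne_of_gt hx
  refine hseq.frequently (Eventually.frequently ?_)
  filter_upwards [self_mem_nhdsWithin] with x hx
  have hx0 : (0 : ℝ) < x := one_pos.trans hx
  have h := integral_cpow_mul_exp_neg_mul_Ioi hs hx0
  simp only [neg_mul]
  rw [h, mul_comm, one_div, inv_cpow _ _ (by
    rw [arg_ofReal_of_nonneg hx0.le]; exact Real.pi_pos.ne), cpow_neg]

/-- The product of geometric series, as a sum over multi-indices. -/
theorem hasSum_prod_geometric {𝕜 : Type*} [RCLike 𝕜] :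
    ∀ {r : ℕ} (x : Fin r → 𝕜), (∀ j, ‖x j‖ < 1) →
      HasSum (fun n : Fin r → ℕ => ∏ j, x j ^ n j) (∏ j, (1 - x j)⁻¹) ∧
      Summable fun n : Fin r → ℕ => ‖∏ j, x j ^ n j‖
  | 0, x, _ => by
    refine ⟨?_, Summable.of_finite⟩
    simp
  | r + 1, x, hx => by
    obtain ⟨ih, ihs⟩ := hasSum_prod_geometric (fun j : Fin r => x j.succ) fun j => hx _
    have h0 := hasSum_geometric_of_norm_lt_one (hx 0)
    have hs0 : Summable fun n : ℕ => ‖x 0 ^ n‖ := by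
      simpa [norm_pow] using summable_geometric_of_lt_one (norm_nonneg _) (hx 0)
    have hs := summable_mul_of_summable_norm hs0 ihs
    have hsn := hs0.mul_norm ihs
    constructor
    · rw [← (Fin.consEquiv fun _ : Fin (r + 1) => ℕ).hasSum_iff, Fin.prod_univ_succ]
      refine (h0.mul ih hs).congr_fun ?_
      intro n
      simp [Fin.prod_univ_succ]
    · rw [← (Fin.consEquiv fun _ : Fin (r + 1) => ℕ).summable_iff]
      refine hsn.congr fun n => ?_
      simp [Fin.prod_univ_succ]

section
variable {r : ℕ} {ω : Fin r → ℂ}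

theorem norm_exp_neg_mul_lt_one {c : ℂ} (hc : 0 < c.re) {t : ℝ} (ht : 0 < t) :
    ‖exp (-c * t)‖ < 1 := by
  rw [norm_exp]
  refine Real.exp_lt_one_iff.2 ?_
  simpa using mul_pos hc ht

theorem prod_exp_pow_mul_exp (ω : Fin r → ℂ) (w : ℂ) (n : Fin r → ℕ) (t : ℂ) :
    (∏ j, exp (-ω j * t) ^ n j) * exp (-w * t) = exp (-(∑ j, (n j : ℂ) * ω j + w) * t) := by
  simp only [← exp_nat_mul]
  rw [← exp_sum, ← exp_add]
  congr 1
  rw [neg_add, add_mul, ← Finset.sum_neg_distrib, Finset.sum_mul]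
  congr 1
  exact Finset.sum_congr rfl fun j _ => by ring

theorem hasSum_genFun_mul_exp (hω : ∀ j, 0 < (ω j).re) (w : ℂ) {t : ℝ} (ht : 0 < t) :
    HasSum (fun n : Fin r → ℕ => exp (-(∑ j, (n j : ℂ) * ω j + w) * t))
      (genFun ω t * exp (-w * t)) := by
  have h := (hasSum_prod_geometric (fun j => exp (-ω j * t)) fun j =>
    norm_exp_neg_mul_lt_one (hω j) ht).1.mul_right (exp (-w * t))
  simp only [prod_exp_pow_mul_exp] at h
  exact h

theorem re_sum_add_pos (hω : ∀ j, 0 < (ω j).re) {w : ℂ} (hw : 0 < w.re) (n : Fin r → ℕ) :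
    0 < (∑ j, (n j : ℂ) * ω j + w).re := by
  rw [add_re, re_sum]
  refine add_pos_of_nonneg_of_pos (Finset.sum_nonneg fun j _ => ?_) hw
  simpa using mul_nonneg (Nat.cast_nonneg _) (hω j).le

/-- Expand `f_ω` into geometric series and integrate termwise by Euler's integral. -/
theorem mellin_genFun_eq (hω : ∀ j, 0 < (ω j).re) {w : ℂ} (hw : 0 < w.re) {s : ℂ}
    (hs : (r : ℝ) < s.re) :
    mellin (fun t : ℝ => genFun ω t * exp (-w * t)) s
      = Gamma s * ∑' n : Fin r → ℕ, (∑ j, (n j : ℂ) * ω j + w) ^ (-s) := by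
  have hs0 : 0 < s.re := lt_of_le_of_lt (Nat.cast_nonneg r) hs
  set f : (Fin r → ℕ) → ℝ → ℂ := fun n t =>
    (t : ℂ) ^ (s - 1) * exp (-(∑ j, (n j : ℂ) * ω j + w) * t) with hf
  have hsum : ∀ {t : ℝ}, 0 < t → HasSum (fun n => f n t)
      ((t : ℂ) ^ (s - 1) * (genFun ω t * exp (-w * t))) := fun ht =>
    (hasSum_genFun_mul_exp hω w ht).mul_left _
  have hfi : ∀ n, IntegrableOn (f n) (Ioi 0) := fun n =>
    integrableOn_cpow_mul_exp hs0 (re_sum_add_pos hω hw n)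
  -- The norms of the terms sum to the norm of the same integrand with `ω`, `w`, `s` replaced by
  -- their real parts. Convergence of that Mellin integral justifies the interchange.
  set ω' : Fin r → ℂ := fun j => ((ω j).re : ℂ) with hω'
  have hω'r : ∀ j, 0 < (ω' j).re := by simpa [hω'] using hω
  have hnorm : ∀ {t : ℝ}, 0 < t → HasSum (fun n => ‖f n t‖)
      ‖(t : ℂ) ^ ((s.re : ℂ) - 1) * (genFun ω' t * exp (-(w.re : ℂ) * t))‖ := by
    intro t ht
    have h1 := (hasSum_prod_geometric (fun j => ‖exp (-ω j * t)‖) fun j => by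
      rw [norm_norm]; exact norm_exp_neg_mul_lt_one (hω j) ht).1.mul_left
        (‖(t : ℂ) ^ (s - 1)‖ * ‖exp (-w * t)‖)
    convert! h1 using 1
    · ext n
      rw [hf]
      simp only
      rw [← prod_exp_pow_mul_exp, norm_mul, norm_mul, norm_prod]
      simp only [norm_pow]
      ring
    · have hprod : genFun ω' t = ((∏ j, (1 - ‖exp (-ω j * t)‖)⁻¹ : ℝ) : ℂ) := by
        rw [genFun, ofReal_prod]
        refine Finset.prod_congr rfl fun j _ => ?_
        rw [norm_exp, ofReal_inv, ofReal_sub, ofReal_one, ofReal_exp]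
        simp [hω']
      have hpos : 0 ≤ ∏ j, (1 - ‖exp (-ω j * t)‖)⁻¹ := Finset.prod_nonneg fun j _ =>
        inv_nonneg.2 (sub_nonneg.2 (norm_exp_neg_mul_lt_one (hω j) ht).le)
      rw [hprod, norm_mul, norm_mul, norm_real, Real.norm_of_nonneg hpos,
        norm_cpow_eq_rpow_re_of_pos ht, norm_cpow_eq_rpow_re_of_pos ht, norm_exp, norm_exp]
      simp
      ring
  have hfin : ∑' n, ∫⁻ t in Ioi (0 : ℝ), ‖f n t‖ₑ ≠ ⊤ := by
    rw [← lintegral_tsum fun n => (hfi n).aestronglyMeasurable.enorm]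
    have hm := mellinConvergent_genFun hω'r (w := (w.re : ℂ)) (by simpa using hw)
      (s := (s.re : ℂ)) (by simpa using hs)
    refine ne_of_lt (lt_of_eq_of_lt ?_ hm.hasFiniteIntegral)
    refine setLIntegral_congr_fun measurableSet_Ioi fun t ht => ?_
    have h := hnorm ht
    simp only [smul_eq_mul, ← ofReal_norm]
    rw [← h.tsum_eq, ENNReal.ofReal_tsum_of_nonneg (fun n => norm_nonneg _) h.summable]
  have h := integral_tsum (fun n => (hfi n).aestronglyMeasurable) hfin
  rw [mellin, ← tsum_mul_left]
  calc _ = ∫ t in Ioi (0 : ℝ), ∑' n, f n t :=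
        setIntegral_congr_fun measurableSet_Ioi fun t ht => (hsum ht).tsum_eq.symm
    _ = _ := by
        rw [h]
        exact tsum_congr fun n => integral_cpow_mul_exp hs0 (re_sum_add_pos hω hw n)

end

/-! ### Hankel's representation of the zeta function, its continuation, and its derivative at `0`.
-/

/-- The kernel `t ^ (s - 1)` in the variable `z = log t`. -/
def powKernel (s z : ℂ) : ℂ := exp ((s - 1) * z)

theorem cutJump_powKernel (F : ℂ → ℂ) (s : ℂ) {t : ℝ} (ht : 0 < t) :
    cutJump F (powKernel s) t
      = (exp (2 * Real.pi * I * s) - 1) * ((t : ℂ) ^ (s - 1) * F t) := by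
  have h1 : exp ((s - 1) * (Real.log t + 2 * Real.pi * I))
      = exp ((s - 1) * Real.log t) * exp (2 * Real.pi * I * s) := by
    rw [← exp_add, ← exp_periodic ((s - 1) * (Real.log t + 2 * Real.pi * I))]
    congr 1
    ring
  have h2 : exp ((s - 1) * Real.log t) = (t : ℂ) ^ (s - 1) := by
    rw [cpow_def_of_ne_zero (ofReal_ne_zero.2 ht.ne'), ofReal_log ht.le, mul_comm]
  rw [cutJump, powKernel, powKernel, h1, h2]
  ring

theorem hasDerivAt_arcIntegral_powKernel {F : ℂ → ℂ} {R ρ : ℝ}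
    (hF : ContinuousOn F (ball 0 R \ {0})) (hρ : 0 < ρ) (hρR : ρ < R) (s : ℂ) :
    HasDerivAt (fun s => arcIntegral F (powKernel s) ρ)
      (arcIntegral F (fun z => z * powKernel s z) ρ) s := by
  set A : ℝ → ℂ := fun θ => F (ρ * exp (θ * I)) * (I * (ρ * exp (θ * I))) with hA
  have hAc : Continuous A := by
    have h : Continuous fun θ : ℝ => F (ρ * exp (θ * I)) := by
      refine hF.comp_continuous (by fun_prop) fun θ => ⟨?_, ?_⟩
      · rw [mem_ball_zero_iff, norm_mul, norm_exp_ofReal_mul_I, norm_real,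
          Real.norm_of_nonneg hρ.le, mul_one]
        exact hρR
      · exact mul_ne_zero (ofReal_ne_zero.2 hρ.ne') (exp_ne_zero _)
    exact h.mul (by fun_prop)
  set ζ : ℝ → ℂ := fun θ => (Real.log ρ : ℂ) + θ * I with hζ
  have hζc : Continuous ζ := by fun_prop
  have h := (intervalIntegral.hasDerivAt_integral_of_dominated_loc_of_deriv_le (μ := volume)
    (a := 0) (b := 2 * Real.pi) (F := fun s θ => A θ * exp ((s - 1) * ζ θ))
    (F' := fun s θ => A θ * (exp ((s - 1) * ζ θ) * (1 * ζ θ)))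
    -- On the unit ball around `s` one has `‖z - 1‖ ≤ ‖s - 1‖ + 1`.
    (bound := fun θ => ‖A θ‖ * (Real.exp ((‖s - 1‖ + 1) * ‖ζ θ‖) * ‖ζ θ‖))
    (ball_mem_nhds s one_pos)
    (Eventually.of_forall fun z => (by fun_prop : Continuous fun θ => A θ * exp ((z - 1) * ζ θ)
      ).aestronglyMeasurable)
    ((by fun_prop : Continuous fun θ => A θ * exp ((s - 1) * ζ θ)).intervalIntegrable _ _)
    ((by fun_prop : Continuous fun θ => A θ * (exp ((s - 1) * ζ θ) * (1 * ζ θ))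
      ).aestronglyMeasurable)
    (Eventually.of_forall fun θ _ z hz => ?_)
    ((by fun_prop : Continuous fun θ => ‖A θ‖ * (Real.exp ((‖s - 1‖ + 1) * ‖ζ θ‖) * ‖ζ θ‖)
      ).intervalIntegrable _ _)
    (Eventually.of_forall fun θ _ z _ =>
      ((((hasDerivAt_id z).sub_const 1).mul_const (ζ θ)).cexp).const_mul (A θ))).2
  · convert! h using 1
    · ext z
      exact intervalIntegral.integral_congr fun θ _ => by
        simp only [hA, hζ, powKernel]; ring
    · exact intervalIntegral.integral_congr fun θ _ => by
        simp only [hA, hζ, powKernel]; ring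
  · rw [norm_mul, norm_mul (exp _), one_mul]
    refine mul_le_mul_of_nonneg_left (mul_le_mul_of_nonneg_right ?_ (norm_nonneg _))
      (norm_nonneg _)
    refine (norm_exp_le_exp_norm _).trans (Real.exp_le_exp.2 ?_)
    rw [norm_mul]
    gcongr
    have h1 := mem_ball_iff_norm.1 hz
    have h2 := norm_add_le (s - 1) (z - s)
    rw [show s - 1 + (z - s) = z - 1 by ring] at h2
    linarith

section
variable {r : ℕ} {ω : Fin r → ℂ}

/-- At `s = 0` the kernel `t^{-1}` is single-valued, so the arc is a genuine circle integral, and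
the residue picks out the Laurent coefficient with `N = 0`. -/
theorem arcIntegral_powKernel_zero (hω : ∀ j, ω j ≠ 0) {ρ : ℝ} (hρ : IsContourRadius ω ρ)
    (w : ℂ) :
    arcIntegral (fun t => genFun ω t * exp (-w * t)) (powKernel 0) ρ
      = 2 * Real.pi * I * multipleBernoulli ω 0 w := by
  obtain ⟨R, hρR, hR⟩ := exists_radius_of_isContourRadius hρ
  obtain ⟨h, hh, e⟩ := exists_laurent_remainder hω (hρ.1.trans hρR) hR w 0 (by linarith)
  have hcirc : arcIntegral (fun t => genFun ω t * exp (-w * t)) (powKernel 0) ρ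
      = ∮ z in C(0, ρ), (∑ N ∈ Finset.Icc (-(r : ℤ)) 0,
          multipleBernoulli ω N w * (z - 0) ^ (N - 1)) + h z := by
    refine intervalIntegral.integral_congr fun θ _ => ?_
    have hne : (ρ : ℂ) * exp (θ * I) ≠ 0 :=
      mul_ne_zero (ofReal_ne_zero.2 hρ.1.ne') (exp_ne_zero _)
    have hk : powKernel 0 ((Real.log ρ : ℂ) + θ * I) = ((ρ : ℂ) * exp (θ * I))⁻¹ := by
      rw [powKernel, zero_sub, neg_one_mul, exp_neg, exp_add, ← ofReal_exp, Real.exp_log hρ.1]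
    simp only [deriv_circleMap, circleMap_zero, sub_zero, smul_eq_mul, hk]
    set z := (ρ : ℂ) * exp (θ * I)
    rw [e z hne]
    have hs : ∑ N ∈ Finset.Icc (-(r : ℤ)) 0, multipleBernoulli ω N w * z ^ (N - 1)
        = (∑ N ∈ Finset.Icc (-(r : ℤ)) 0, multipleBernoulli ω N w * z ^ N) * z⁻¹ := by
      rw [Finset.sum_mul]
      refine Finset.sum_congr rfl fun N _ => ?_
      rw [zpow_sub_one₀ hne, mul_assoc]
    rw [hs]
    simp only [zero_add, zpow_one]
    field_simp
  have hsph : (0 : ℂ) ∉ sphere (0 : ℂ) |ρ| := by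
    simpa using (abs_pos.2 hρ.1.ne').ne
  have hci : ∀ N ∈ Finset.Icc (-(r : ℤ)) 0, CircleIntegrable
      (fun z => multipleBernoulli ω N w * (z - 0) ^ (N - 1)) 0 ρ := fun N _ =>
    (circleIntegrable_sub_zpow_iff.2 (Or.inr (Or.inr hsph))).const_mul _
  have hhc : ContinuousOn h (closedBall 0 ρ) :=
    hh.continuousOn.mono (closedBall_subset_ball hρR)
  rw [hcirc, circleIntegral.integral_add (CircleIntegrable.fun_sum _ hci)
    ((hhc.mono sphere_subset_closedBall).circleIntegrable hρ.1.le),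
    circleIntegral.integral_fun_sum hci,
    circleIntegral_eq_zero_of_differentiable_on_off_countable hρ.1.le countable_empty hhc
      (fun z hz => hh.differentiableAt (isOpen_ball.mem_nhds (ball_subset_ball hρR.le hz.1))),
    add_zero]
  simp only [circleIntegral.integral_const_mul]
  rw [Finset.sum_eq_single 0]
  · simp only [zero_sub, zpow_neg_one]
    rw [circleIntegral.integral_sub_center_inv 0 hρ.1.ne', mul_comm]
  · intro N _ hN
    rw [circleIntegral.integral_sub_zpow_of_ne (by omega), mul_zero]
  · intro h0
    exact absurd (Finset.mem_Icc.2 ⟨by omega, le_rfl⟩) h0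

/-- On the circle of radius `x` the integrand is `O(x^{Re s - 1 - r})`, and the length contributes
another `x`. -/
theorem tendsto_arcIntegral_powKernel (hω : ∀ j, ω j ≠ 0) (w : ℂ) {s : ℂ}
    (hs : (r : ℝ) < s.re) :
    Tendsto (arcIntegral (fun t => genFun ω t * exp (-w * t)) (powKernel s)) (𝓝[>] 0) (𝓝 0) := by
  obtain ⟨A, R, hR, hA⟩ := exists_norm_genFun_mul_exp_le hω w
  refine squeeze_zero_norm' (a := fun x =>
    A * Real.exp (|s.im| * (2 * Real.pi)) * (2 * Real.pi) * x ^ (s.re - r)) ?_ ?_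
  · filter_upwards [Ioc_mem_nhdsGT hR] with x hx
    refine (norm_arcIntegral_le hx.1 (A := A * x ^ (-(r : ℝ)))
      (B := x ^ (s.re - 1) * Real.exp (|s.im| * (2 * Real.pi)))
      (fun t ht => ?_) fun θ hθ => ?_).trans_eq ?_
    · rw [← ht]
      exact hA t (norm_pos_iff.1 (by rw [ht]; exact hx.1)) (by rw [ht]; exact hx.2)
    · rw [powKernel, norm_exp, Real.rpow_def_of_pos hx.1, ← Real.exp_add]
      refine Real.exp_le_exp.2 ?_
      have : ((s - 1) * ((Real.log x : ℂ) + θ * I)).re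
          = Real.log x * (s.re - 1) + -s.im * θ := by
        simp; ring
      rw [this]
      have h1 : -s.im * θ ≤ |s.im| * (2 * Real.pi) :=
        mul_le_mul (neg_le_abs _) hθ.2 hθ.1 (abs_nonneg _)
      linarith
    · rw [sub_eq_add_neg s.re (r : ℝ), Real.rpow_add hx.1, Real.rpow_sub_one hx.1.ne']
      have := hx.1.ne'
      field_simp
  · have h : Tendsto (fun x : ℝ => x ^ (s.re - r)) (𝓝[>] 0) (𝓝 0) := by
      have := (Real.continuousAt_rpow_const 0 (s.re - r) (Or.inr (by linarith))).tendsto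
      rw [Real.zero_rpow (by linarith)] at this
      exact this.mono_left nhdsWithin_le_nhds
    simpa using h.const_mul (A * Real.exp (|s.im| * (2 * Real.pi)) * (2 * Real.pi))

theorem arcIntegral_powKernel_eq (hω : ∀ j, 0 < (ω j).re) {ρ : ℝ} (hρ : IsContourRadius ω ρ)
    {w : ℂ} (hw : 0 < w.re) {s : ℂ} (hs : (r : ℝ) < s.re) :
    arcIntegral (fun t => genFun ω t * exp (-w * t)) (powKernel s) ρ
      = (exp (2 * Real.pi * I * s) - 1) *
        ∫ t in Ioc 0 ρ, (t : ℂ) ^ (s - 1) * (genFun ω t * exp (-w * t)) := by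
  obtain ⟨R, hρR, hR⟩ := exists_radius_of_isContourRadius hρ
  have hm : IntegrableOn (fun t : ℝ => (t : ℂ) ^ (s - 1) * (genFun ω t * exp (-w * t)))
    (Ioi 0) := mellinConvergent_genFun hω hw hs
  have hjump : ∀ t ∈ Ioc 0 ρ, (exp (2 * Real.pi * I * s) - 1) *
      ((t : ℂ) ^ (s - 1) * (genFun ω t * exp (-w * t)))
      = cutJump (fun t => genFun ω t * exp (-w * t)) (powKernel s) t :=
    fun t ht => (cutJump_powKernel (fun t => genFun ω t * exp (-w * t)) s ht.1).symm
  have hF : DifferentiableOn ℂ (fun t => genFun ω t * exp (-w * t)) (ball 0 R \ {0}) := by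
    simpa using differentiableOn_genFun_mul (ne_zero_of_re hω) hR w 0
  rw [arcIntegral_eq_integral hF (by unfold powKernel; fun_prop) hρ.1 hρR
    ((intervalIntegrable_iff_integrableOn_Ioc_of_le hρ.1.le).2
      (IntegrableOn.congr_fun ((hm.mono_set Ioc_subset_Ioi_self).const_mul _) hjump
        measurableSet_Ioc))
    (tendsto_arcIntegral_powKernel (ne_zero_of_re hω) w hs),
    intervalIntegral.integral_of_le hρ.1.le, ← integral_const_mul]
  exact (setIntegral_congr_fun measurableSet_Ioc hjump).symm

/-- The part of the Mellin transform of `f_ω(t) e^{-wt}` over the half-line from `ρ` to `∞`. -/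
def tailMellin (ω : Fin r → ℂ) (ρ : ℝ) (w s : ℂ) : ℂ :=
  mellin ((Ioi ρ).indicator fun t : ℝ => genFun ω t * exp (-w * t)) s

theorem tailMellin_eq {ρ : ℝ} (hρ : 0 < ρ) (w s : ℂ) :
    tailMellin ω ρ w s = ∫ t in Ioi ρ, (t : ℂ) ^ (s - 1) * (genFun ω t * exp (-w * t)) := by
  have : ∀ t : ℝ, (t : ℂ) ^ (s - 1) • (Ioi ρ).indicator
      (fun t : ℝ => genFun ω t * exp (-w * t)) t = (Ioi ρ).indicator
      (fun t : ℝ => (t : ℂ) ^ (s - 1) * (genFun ω t * exp (-w * t))) t := fun t => by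
    by_cases ht : t ∈ Ioi ρ <;> simp [ht]
  simp only [tailMellin, mellin, this]
  rw [setIntegral_indicator measurableSet_Ioi, inter_eq_self_of_subset_right
    (Ioi_subset_Ioi hρ.le)]

theorem differentiable_tailMellin (hω : ∀ j, 0 < (ω j).re) {ρ : ℝ} (hρ : 0 < ρ) {w : ℂ}
    (hw : 0 < w.re) : Differentiable ℂ (tailMellin ω ρ w) := fun s => by
  have hint : IntegrableOn (fun t : ℝ => genFun ω t * exp (-w * t)) (Ioi ρ) := by
    simpa using integrableOn_genFun hω hw 0 hρ
  -- The truncated function vanishes near `0`, so any exponent `b < Re s` is admissible there; this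
  -- is why the tail is entire in `s`.
  refine mellin_differentiableAt_of_isBigO_rpow_exp (a := w.re / 2) (b := s.re - 1)
    (by positivity) ?_ ?_ ?_ (by linarith)
  · exact ((integrable_indicator_iff measurableSet_Ioi).2 hint).locallyIntegrable
      |>.locallyIntegrableOn _
  · refine ((subExp_genFun hω).mul_exp_isBigO (w := w) (b := w.re / 2) (by linarith)).congr' ?_
      EventuallyEq.rfl
    filter_upwards [eventually_gt_atTop ρ] with t ht
    rw [indicator_of_mem (mem_Ioi.2 ht)]
  · refine (isBigO_zero _ _).congr' ?_ EventuallyEq.rfl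
    filter_upwards [Ioc_mem_nhdsGT hρ] with t ht
    rw [indicator_of_notMem]
    exact fun h => absurd ht.2 (not_le.2 h)

/-- The integral of `f_ω(t) e^{-wt} t ^ (s - 1)` over the Hankel contour. -/
def hankelPowIntegral (ω : Fin r → ℂ) (ρ : ℝ) (w s : ℂ) : ℂ :=
  arcIntegral (fun t => genFun ω t * exp (-w * t)) (powKernel s) ρ
    + (exp (2 * Real.pi * I * s) - 1) * tailMellin ω ρ w s

theorem hasDerivAt_hankelPowIntegral (hω : ∀ j, 0 < (ω j).re) {ρ : ℝ}
    (hρ : IsContourRadius ω ρ) {w : ℂ} (hw : 0 < w.re) (s : ℂ) :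
    HasDerivAt (hankelPowIntegral ω ρ w)
      (arcIntegral (fun t => genFun ω t * exp (-w * t)) (fun z => z * powKernel s z) ρ
        + (exp (2 * Real.pi * I * s) * (2 * Real.pi * I) * tailMellin ω ρ w s
          + (exp (2 * Real.pi * I * s) - 1) * deriv (tailMellin ω ρ w) s)) s := by
  obtain ⟨R, hρR, hR⟩ := exists_radius_of_isContourRadius hρ
  have hF : DifferentiableOn ℂ (fun t => genFun ω t * exp (-w * t)) (ball 0 R \ {0}) := by
    simpa using differentiableOn_genFun_mul (ne_zero_of_re hω) hR w 0
  have h1 := hasDerivAt_arcIntegral_powKernel hF.continuousOn hρ.1 hρR s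
  have h2 := (((hasDerivAt_id s).const_mul (2 * Real.pi * I)).cexp).sub_const 1
  have h3 := (differentiable_tailMellin hω hρ.1 hw s).hasDerivAt
  convert! h1.add (h2.mul h3) using 1
  simp only [id, mul_one]

theorem hankelPowIntegral_eq_mellin (hω : ∀ j, 0 < (ω j).re) {ρ : ℝ}
    (hρ : IsContourRadius ω ρ) {w : ℂ} (hw : 0 < w.re) {s : ℂ} (hs : (r : ℝ) < s.re) :
    hankelPowIntegral ω ρ w s = (exp (2 * Real.pi * I * s) - 1) *
      mellin (fun t : ℝ => genFun ω t * exp (-w * t)) s := by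
  have hm : IntegrableOn (fun t : ℝ => (t : ℂ) ^ (s - 1) * (genFun ω t * exp (-w * t)))
    (Ioi 0) := mellinConvergent_genFun hω hw hs
  rw [hankelPowIntegral, arcIntegral_powKernel_eq hω hρ hw hs, tailMellin_eq hρ.1, ← mul_add,
    ← setIntegral_union (Ioc_disjoint_Ioi le_rfl) measurableSet_Ioi
      (hm.mono_set Ioc_subset_Ioi_self) (hm.mono_set (Ioi_subset_Ioi hρ.1.le)),
    Ioc_union_Ioi_eq_Ioi hρ.1.le]
  rfl

/-- The contour integral representation of the multiple Hurwitz zeta function. -/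
def hankelZeta (ω : Fin r → ℂ) (ρ : ℝ) (w s : ℂ) : ℂ :=
  1 / (2 * Real.pi * I) * (Gamma (1 - s) * exp (-(Real.pi * I) * s) * hankelPowIntegral ω ρ w s)

/-- The series of the multiple Hurwitz zeta function. -/
def zetaSeries (ω : Fin r → ℂ) (w s : ℂ) : ℂ :=
  ∑' n : Fin r → ℕ, (∑ j, (n j : ℂ) * ω j + w) ^ (-s)

theorem Gamma_ne_zero_of_re_gt {s : ℂ} (hs : (r : ℝ) < s.re) : Gamma s ≠ 0 :=
  Gamma_ne_zero_of_re_pos (lt_of_le_of_lt (Nat.cast_nonneg r) hs)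

/-- Since `e^{-πis} (e^{2πis} - 1) = 2i sin πs`, the reflection formula cancels all factors. At the
integers `s > r` the factor `Γ(1 - s)` has a pole, hence the condition on the sine. -/
theorem hankelZeta_eq_zetaSeries (hω : ∀ j, 0 < (ω j).re) {ρ : ℝ}
    (hρ : IsContourRadius ω ρ) {w : ℂ} (hw : 0 < w.re) {s : ℂ} (hs : (r : ℝ) < s.re)
    (hsin : sin (Real.pi * s) ≠ 0) : hankelZeta ω ρ w s = zetaSeries ω w s := by
  rw [hankelZeta, hankelPowIntegral_eq_mellin hω hρ hw hs, mellin_genFun_eq hω hw hs, ← zetaSeries]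
  have hG := Gamma_mul_Gamma_one_sub s
  have hexp : exp (-(Real.pi * I) * s) * (exp (2 * Real.pi * I * s) - 1)
      = 2 * I * sin (Real.pi * s) := by
    rw [mul_sub, ← exp_add, sin, mul_one,
      show -(Real.pi * I) * s + 2 * Real.pi * I * s = Real.pi * s * I by ring,
      show -(Real.pi * I) * s = -(Real.pi * s) * I by ring]
    linear_combination (exp (Real.pi * s * I) - exp (-(Real.pi * s) * I)) * I_mul_I
  have hpi : (Real.pi : ℂ) ≠ 0 := ofReal_ne_zero.2 Real.pi_ne_zero
  rw [eq_div_iff hsin] at hG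
  calc _ = 1 / (2 * Real.pi * I) * ((Gamma s * Gamma (1 - s))
        * (exp (-(Real.pi * I) * s) * (exp (2 * Real.pi * I * s) - 1)) * zetaSeries ω w s) := by
        ring
    _ = 1 / (Real.pi : ℂ) * (Gamma s * Gamma (1 - s) * sin (Real.pi * s)) * zetaSeries ω w s := by
        rw [hexp]
        field_simp
    _ = _ := by
        rw [hG]
        field_simp

theorem eventually_sin_pi_mul_ne_zero (s : ℂ) : ∀ᶠ z in 𝓝[≠] s, sin (Real.pi * z) ≠ 0 := by
  by_cases h : sin (Real.pi * s) = 0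
  · have hd : HasDerivAt (fun z : ℂ => sin (Real.pi * z)) (cos (Real.pi * s) * (Real.pi * 1)) s :=
      ((hasDerivAt_id s).const_mul (Real.pi : ℂ)).csin
    refine hd.eventually_ne ?_
    have h1 := sin_sq_add_cos_sq (Real.pi * s)
    rw [h] at h1
    have h2 : cos (Real.pi * s) ≠ 0 := by
      intro h0
      simp [h0] at h1
    exact mul_ne_zero h2 (by simp [Real.pi_ne_zero])
  · exact ((by fun_prop : Continuous fun z : ℂ => sin (Real.pi * z)).continuousAt.eventually_ne
      h).filter_mono nhdsWithin_le_nhds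

/-- The multiple Hurwitz zeta function, by its series where that converges and by the contour
integral elsewhere. -/
def zetaExtension (ω : Fin r → ℂ) (ρ : ℝ) (w s : ℂ) : ℂ :=
  open Classical in if (r : ℝ) < s.re then zetaSeries ω w s else hankelZeta ω ρ w s

theorem zetaExtension_eventuallyEq (hω : ∀ j, 0 < (ω j).re) {ρ : ℝ}
    (hρ : IsContourRadius ω ρ) {w : ℂ} (hw : 0 < w.re) {s : ℂ} (hs : s.re ≤ r) :
    zetaExtension ω ρ w =ᶠ[𝓝 s] hankelZeta ω ρ w := by
  -- Zeros of the sine are isolated, so only `z = s` could be exceptional; there `Re s ≤ r`, and the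
  -- two functions agree by definition.
  filter_upwards [eventually_nhdsWithin_iff.1 (eventually_sin_pi_mul_ne_zero s)] with z hz
  rw [zetaExtension]
  split_ifs with h
  · refine (hankelZeta_eq_zetaSeries hω hρ hw h (hz ?_)).symm
    rintro rfl
    exact absurd h (not_lt.2 hs)
  · rfl

theorem isZetaContinuation_zetaExtension (hω : ∀ j, 0 < (ω j).re) {ρ : ℝ}
    (hρ : IsContourRadius ω ρ) {w : ℂ} (hw : 0 < w.re) :
    IsZetaContinuation ω w (zetaExtension ω ρ w) := by
  refine ⟨fun s hs => DifferentiableAt.differentiableWithinAt ?_, fun s hs => ?_⟩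
  · rcases lt_or_ge (r : ℝ) s.re with h | h
    · have he : zetaExtension ω ρ w =ᶠ[𝓝 s]
          fun z => mellin (fun t : ℝ => genFun ω t * exp (-w * t)) z / Gamma z := by
        filter_upwards [(isOpen_lt continuous_const continuous_re).mem_nhds h] with z hz
        rw [zetaExtension, if_pos hz, mellin_genFun_eq hω hw hz,
          mul_div_cancel_left₀ _ (Gamma_ne_zero_of_re_gt hz)]
        rfl
      refine he.differentiableAt_iff.2 ?_
      simp only [div_eq_mul_inv]
      exact (differentiableAt_mellin_genFun hω hw h).mul (differentiable_one_div_Gamma s)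
    · refine (zetaExtension_eventuallyEq hω hρ hw h).differentiableAt_iff.2 ?_
      have hG : DifferentiableAt ℂ (fun s => Gamma (1 - s)) s := by
        refine DifferentiableAt.comp s (differentiableAt_Gamma _ fun m hm => hs ?_) (by fun_prop)
        -- A pole of `Γ(1 - s)` with `Re s ≤ r` would be one of the points `1, …, r`, which are
        -- excluded.
        have e : s = ((m + 1 : ℕ) : ℂ) := by
          push_cast
          linear_combination -hm
        refine ⟨m + 1, ⟨by omega, ?_⟩, e.symm⟩
        rw [e, natCast_re] at h
        exact_mod_cast h
      exact ((hG.mul (by fun_prop)).mul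
        (hasDerivAt_hankelPowIntegral hω hρ hw s).differentiableAt).const_mul _
  · rw [zetaExtension, if_pos hs, zetaSeries]

/-- Product rule at `s = 0`: `Γ(1 - s)` contributes `γ`, `e^{-πis}` contributes `-πi`, each times
the residue `a_{r,0}(w;ω)`. In the contour integral the derivative brings down `log t` on the arc
and `2πi` on the tail. -/
theorem hasDerivAt_hankelZeta_zero (hω : ∀ j, 0 < (ω j).re) {ρ : ℝ}
    (hρ : IsContourRadius ω ρ) {w : ℂ} (hw : 0 < w.re) :
    HasDerivAt (hankelZeta ω ρ w) (modifiedGamma ρ ω 0 w) 0 := by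
  have h1 : HasDerivAt (fun s : ℂ => Gamma (1 - s)) (Real.eulerMascheroniConstant : ℂ) 0 := by
    have hG : HasDerivAt Gamma (-(Real.eulerMascheroniConstant : ℂ)) (1 - 0) := by
      rw [sub_zero]
      exact hasDerivAt_Gamma_one
    simpa using hG.comp_const_sub 1 0
  have h2 := ((hasDerivAt_id (0 : ℂ)).const_mul (-(Real.pi * I))).cexp
  have h3 := hasDerivAt_hankelPowIntegral hω hρ hw 0
  have h := ((h1.mul h2).mul h3).const_mul (1 / (2 * Real.pi * I))
  have hI : hankelPowIntegral ω ρ w 0 = 2 * Real.pi * I * multipleBernoulli ω 0 w := by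
    rw [hankelPowIntegral, arcIntegral_powKernel_zero (ne_zero_of_re hω) hρ]
    simp
  have harc : arcIntegral (fun t => genFun ω t * exp (-w * t)) (fun z => z * powKernel 0 z) ρ
      = arcIntegral (fun t => genFun ω t * exp (-w * t) * t ^ (-(0 : ℤ) - 1)) (fun z => z) ρ := by
    refine intervalIntegral.integral_congr fun θ _ => ?_
    have hk : powKernel 0 ((Real.log ρ : ℂ) + θ * I) = ((ρ : ℂ) * exp (θ * I))⁻¹ := by
      rw [powKernel, zero_sub, neg_one_mul, exp_neg, exp_add, ← ofReal_exp, Real.exp_log hρ.1]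
    simp only [hk, neg_zero, zero_sub, zpow_neg_one]
    ring
  have htail : tailMellin ω ρ w 0
      = ∫ t in Ioi ρ, genFun ω t * exp (-w * t) * (t : ℂ) ^ (-(0 : ℤ) - 1) := by
    rw [tailMellin_eq hρ.1]
    congr 1
    ext t
    rw [zero_sub, cpow_neg_one, neg_zero, zero_sub, zpow_neg_one, mul_comm]
  convert! h using 1
  rw [modifiedGamma_eq hω hw 0 hρ.1, hI, harc, ← htail]
  have := two_pi_I_ne_zero
  simp only [id, Pi.mul_apply, mul_zero, exp_zero, sub_zero, Gamma_one, mul_one, one_mul, sub_self, zero_mul,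
    add_zero]
  field_simp
  ring

/-- The explicit extension shows that a continuation exists, so the chosen one is a continuation; by
uniqueness it equals the contour integral near `0`. -/
theorem logMultipleGamma_eq_modifiedGamma (hω : ∀ j, 0 < (ω j).re) {ρ : ℝ}
    (hρ : IsContourRadius ω ρ) {w : ℂ} (hw : 0 < w.re) :
    logMultipleGamma ω w = modifiedGamma ρ ω 0 w := by
  have hZ := isZetaContinuation_zetaExtension hω hρ hw
  have hspec : IsZetaContinuation ω w (multipleHurwitzZeta ω w) :=
    Classical.epsilon_spec ⟨_, hZ⟩
  have h0 : (0 : ℂ) ∈ (zetaPoles r)ᶜ := by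
    rintro ⟨m, hm, e⟩
    have : m = 0 := Nat.cast_eq_zero.1 e
    have := hm.1
    omega
  have he : multipleHurwitzZeta ω w =ᶠ[𝓝 0] hankelZeta ω ρ w :=
    ((hspec.unique hZ).eventuallyEq_of_mem
      ((zetaPoles_finite r).isClosed.isOpen_compl.mem_nhds h0)).trans
      (zetaExtension_eventuallyEq hω hρ hw (by simp))
  rw [logMultipleGamma, he.deriv_eq]
  exact (hasDerivAt_hankelZeta_zero hω hρ hw).deriv

end

end BMGamma

end

theorem theorem1p1 (r l : ℕ) (ω : Fin r → ℂ) (α : Fin l → ℂ)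
    (hω : ∀ j, 0 < (ω j).re) (hα : ∀ j, 0 < (α j).re) (a : ℂ)
    (ρ ρ' : ℝ) (hρ : BMGamma.IsContourRadius (Fin.append ω α) ρ)
    (hρ' : BMGamma.IsContourRadius ω ρ') :
    (∀ k : ℤ, -((r : ℤ) + (l : ℤ)) ≤ k →
      (fun w : ℂ => BMGamma.modifiedGamma ρ (Fin.append ω α) k (w + a)
          - ∑ N ∈ Finset.Icc (-(l : ℤ)) ((r : ℤ) + k),
              BMGamma.multipleBernoulli α N a * BMGamma.modifiedGamma ρ' ω (k - N) w)
        =O[BMGamma.atInfinity a] (fun w : ℂ => 1 / w)) ∧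
    (fun w : ℂ => BMGamma.logMultipleGamma (Fin.append ω α) (w + a)
        - ∑ N ∈ Finset.Icc (-(l : ℤ)) (r : ℤ),
            BMGamma.multipleBernoulli α N a * BMGamma.modifiedGamma ρ' ω (-N) w)
      =O[BMGamma.atInfinity a] (fun w : ℂ => 1 / w) := by
  have main := fun (k : ℤ) (hk : -((r : ℤ) + (l : ℤ)) ≤ k) =>
    BMGamma.modifiedGamma_append_isBigO hω hα a hρ hρ' hk
  refine ⟨main, (main 0 (by linarith)).congr' ?_ EventuallyEq.rfl⟩
  filter_upwards [BMGamma.eventually_atInfinity a 0] with w hw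
  rw [BMGamma.logMultipleGamma_eq_modifiedGamma (BMGamma.append_re_pos hω hα) hρ hw.2.1]
  simp only [add_zero, zero_sub]
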